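/- Let $\alpha>0$ and $\nu>0$ be real. For $d,r\in\mathbb N$, $d\ge 1$, let $\mathcal M_b$ be the space of bounded measurable functions $\mathbb R^d\to\mathbb R$, $\mathcal C_b^r$ (resp. $\mathcal C_1^r$) the $C^r$ functions whose partial derivatives $\partial^\gamma f$, $|\gamma|\le r$, are all bounded (resp. integrable), $\mathcal C^\infty_b=\bigcap_r\mathcal C_b^r$, $\|f\|_{r,\infty}=\sum_{|\gamma|\le r}\|\partial^\gamma f\|_\infty$ and $\|f\|_{r,1}=\sum_{|\gamma|\le r}\|\partial^\gamma f\|_{L^1}$. For $l\in\mathbb N$, $\mu\in\mathbb R$, $i\ge 1$, $\beta\in\mathbb N$ put $$m(l,\mu)=\max\Big(0,\Big\lceil\tfrac{\mu}{(1+\alpha)l+\alpha}\Big\rceil\Big),\qquad q_i(l,\mu)=\mu+\lceil i-(1+\alpha)(l+1)(i-1)\rceil,\qquad l(\nu,\alpha)=\lceil\nu/\alpha\rceil,$$ $$\kappa(l,\mu)=\max\Big\{\beta\, m(l,\mu),\ \max_{1\le i\le m(l,\mu)-1} i\,\kappa(l+1,q_i(l,\mu))\Big\},\qquad q_\nu=\max_{1\le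 i\le m(0,\nu)} i\max\big(\beta,\kappa(1,q_i(0,\nu))\big)$$ (the recursion for $\kappa$ terminates). For $T>0$ and $n\in\mathbb N^*$ put $\delta_n^l=T/n^l$ and $\pi^{\delta}=\{k\delta:k\in\mathbb N\}$. All operators below are linear operators on $\mathcal M_b$ given by finite signed kernels, $Af(x)=\int f(y)\,A(x,dy)$ (for instance Markov operators), and $A^*$ is the dual of $A$ for the $L^2$ scalar product, i.e. $\langle Ag,f\rangle=\langle g,A^*f\rangle$ for $g\in\mathcal M_b$. Let $(P_{s,t})_{0\le s\le t\le T}$ and, for $1\le l\le l(\nu,\alpha)$, $(Q^{\delta_n^l}_{s,t})_{s\le t,\ s,t\in\pi^{\delta_n^l}\cap[0,T]}$ be semigroups: $P_{t,t}=\mathrm{Id}$, $P_{s,u}P_{u,t}=P_{s,t}$ for $s\le u\le t$, and likewise for each $Q^{\delta_n^l}$. For $t\in\pi^{\delta_n^l}$, $t+\delta_n^l\le T$, define recursively (the recursion terminates, and $\hat Q^{\nu,\delta_n^0}_{0,T}$ only involves $Q^{\delta_n^l}$ with $1\le l\le l(\nu,\alpha)$) $$\hat Q^{\mu,\delta_n^l}_{t,t+\delta_n^l}=Q^{\delta_n^{l+1}}_{t,t+\delta_n^l}+\sum_{i=1}^{m(l,\mu)-1}\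 \sum_{t=t_0<t_1<\dots<t_i\le t+\delta_n^l,\ t_j\in\pi^{\delta_n^{l+1}}}\Big(\prod_{j=1}^i Q^{\delta_n^{l+1}}_{t_{j-1},t_j-\delta_n^{l+1}}\big(\hat Q^{q_i(l,\mu),\delta_n^{l+1}}_{t_j-\delta_n^{l+1},t_j}-Q^{\delta_n^{l+1}}_{t_j-\delta_n^{l+1},t_j}\big)\Big)Q^{\delta_n^{l+1}}_{t_i,t+\delta_n^l},$$ the products being ordered with increasing $j$ from left to right. **Theorem.** There is $p\ge 0$ depending only on $\nu$ and $\alpha$ such that, for all $d\in\mathbb N^*$, $\beta\in\mathbb N$, $\eta\ge 0$ and constants $(K_r)_{r\in\mathbb N}$, there is $C$ depending only on $\alpha,\nu,d,\beta,\eta,(K_r)_r$ with the following property. Let $T>0$, $n\in\mathbb N^*$, with $n>m(0,\nu)$ unless $\eta=0$, and let $P$, $Q^{\delta_n^l}$ be as above and such that, for all $r\in\mathbb N$ and $1\le l\le l(\nu,\alpha)$, with all times in $[0,T]$: 1. (propagation of regularity) for $f\in\mathcal C_b^r$ and $A=P_{s,t}$ ($s\le t$) or $A=Q^{\delta_n^l}_{s,t}$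 ($s\le t$ in $\pi^{\delta_n^l}$), $Af\in\mathcal C_b^r$ and $\|Af\|_{r,\infty}\le K_r\|f\|_{r,\infty}$; for $f\in\mathcal C_1^r$ and the same $A$, $A^*f$ exists in $\mathcal C_1^r$ and $\|A^*f\|_{r,1}\le K_r\|f\|_{r,1}$; 2. (short time errors) for $t\in\pi^{\delta_n^l}$, $\|P_{t,t+\delta_n^l}f-Q^{\delta_n^l}_{t,t+\delta_n^l}f\|_{r,\infty}\le K_r\|f\|_{\beta+r,\infty}(\delta_n^l)^{\alpha+1}$ for $f\in\mathcal C_b^{\beta+r}$, and $\|P^*_{t,t+\delta_n^l}f-Q^{\delta_n^l,*}_{t,t+\delta_n^l}f\|_{r,1}\le K_r\|f\|_{\beta+r,1}(\delta_n^l)^{\alpha+1}$ for $f\in\mathcal C_1^{\beta+r}$; 3. (regularization, $R_{q_\nu,\eta}$ for $Q^{\delta_n^1}$ and $P$) for every multi-index $\gamma$ with $|\gamma|+r\le q_\nu$ and every $f\in\mathcal C_b^\infty$, $\|A_{s,t}\,\partial^\gamma f\|_{r,\infty}\le K_r(t-s)^{-\eta}\|f\|_\infty$ for $A=Q^{\delta_n^1}$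 and $s<t$ in $\pi^{\delta_n^1}$, and for $A=P$ and $s<t$. Then, for every $f\in\mathcal M_b$, $$\|P_{0,T}f-\hat Q^{\nu,\delta_n^0}_{0,T}f\|_\infty\le\frac1{n^\nu}\,\|f\|_\infty\,\frac{C(1+T^p)}{T(\nu)^\eta},\qquad T(\nu)=\inf\Big\{t\in\pi^{\delta_n^1}:\ t\ge T\,\frac{n-m(0,\nu)}{n(m(0,\nu)+1)}\Big\}.$$ -/

import Mathlib

open MeasureTheory

noncomputable section

namespace WeakApprox

/-- The space `ℝ^d`. -/
abbrev E (d : ℕ) : Type := EuclideanSpace ℝ (Fin d)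

/-- The space of bounded measurable functions from `ℝ^d` to `ℝ`. -/
def Mb (d : ℕ) : Submodule ℝ (E d → ℝ) where
  carrier := {f | Measurable f ∧ ∃ C : ℝ, ∀ x, |f x| ≤ C}
  zero_mem' := ⟨measurable_const, 0, fun x => by simp⟩
  add_mem' := by
    rintro f g ⟨hf, C, hC⟩ ⟨hg, D, hD⟩
    exact ⟨hf.add hg, C + D, fun x => (abs_add_le _ _).trans (add_le_add (hC x) (hD x))⟩
  smul_mem' := by
    rintro c f ⟨hf, C, hC⟩
    refine ⟨hf.const_smul c, |c| * C, fun x => ?_⟩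
    simpa [abs_mul] using mul_le_mul_of_nonneg_left (hC x) (abs_nonneg c)

/-- Linear operators on bounded measurable functions; `A * B` is the composition `f ↦ A (B f)`. -/
abbrev Op (d : ℕ) : Type := Module.End ℝ (Mb d)

/-- `A` is given by a (possibly signed) kernel `A f x = ∫ f(y) A(x, dy)`, where each `A(x, ·)` is
a difference of two finite measures. Markov operators are the special case in which `A(x, ·)` is a
probability measure. -/
def IsKernelOp {d : ℕ} (A : Op d) : Prop :=
  ∀ x : E d, ∃ μ₁ μ₂ : Measure (E d), IsFiniteMeasure μ₁ ∧ IsFiniteMeasure μ₂ ∧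
    ∀ f : Mb d, (A f : E d → ℝ) x
      = (∫ y, (f : E d → ℝ) y ∂μ₁) - ∫ y, (f : E d → ℝ) y ∂μ₂

/-! ### Derivatives, function classes and norms -/

/-- The partial derivative `∂_i f`. -/
def partialD {d : ℕ} (i : Fin d) (f : E d → ℝ) : E d → ℝ :=
  fun x => fderiv ℝ f x (EuclideanSpace.single i 1)

/-- Iterated partial derivatives along a list of coordinates. -/
def iterPartial {d : ℕ} : List (Fin d) → (E d → ℝ) → E d → ℝ
  | [], f => f
  | i :: w, f => partialD i (iterPartial w f)

/-- `∂^γ f = ∂_1^{γ_1} ⋯ ∂_d^{γ_d} f` for a multi-index `γ`. -/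
def multiD {d : ℕ} (γ : Fin d → ℕ) (f : E d → ℝ) : E d → ℝ :=
  iterPartial ((List.finRange d).flatMap fun i => List.replicate (γ i) i) f

/-- The multi-indices `γ` with `|γ| ≤ r`. -/
def multiIdx (d r : ℕ) : Finset (Fin d → ℕ) :=
  (Fintype.piFinset fun _ => Finset.range (r + 1)).filter fun γ => ∑ i, γ i ≤ r

/-- `‖f‖_∞`; used for bounded functions only. -/
def supNorm {d : ℕ} (f : E d → ℝ) : ℝ := ⨆ x, |f x|

/-- `‖f‖_{r,∞} = ∑_{|γ| ≤ r} ‖∂^γ f‖_∞`. -/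
def normSup {d : ℕ} (r : ℕ) (f : E d → ℝ) : ℝ := ∑ γ ∈ multiIdx d r, supNorm (multiD γ f)

/-- `‖f‖_{r,1} = ∑_{|γ| ≤ r} ‖∂^γ f‖_{L^1}`. -/
def normL1 {d : ℕ} (r : ℕ) (f : E d → ℝ) : ℝ := ∑ γ ∈ multiIdx d r, ∫ x, |multiD γ f x|

/-- `f ∈ C_b^r`. -/
def IsCb {d : ℕ} (r : ℕ) (f : E d → ℝ) : Prop :=
  ContDiff ℝ r f ∧ ∀ γ ∈ multiIdx d r, ∃ C : ℝ, ∀ x, |multiD γ f x| ≤ C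

/-- `f ∈ C_1^r`. -/
def IsC1 {d : ℕ} (r : ℕ) (f : E d → ℝ) : Prop :=
  ContDiff ℝ r f ∧ ∀ γ ∈ multiIdx d r, Integrable (multiD γ f)

/-! ### Dual operators -/

/-- `h = A^* f` for the `L^2` pairing: `⟨A g, f⟩ = ⟨g, h⟩` for all bounded measurable `g`
(here `f` and `h` are integrable). -/
def IsDualImage {d : ℕ} (A : Op d) (f h : E d → ℝ) : Prop :=
  ∀ g : Mb d, ∫ x, (A g : E d → ℝ) x * f x = ∫ x, (g : E d → ℝ) x * h x

/-- `A^* f` exists as a continuous integrable function (which is then unique). -/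
def HasDual {d : ℕ} (A : Op d) (f : E d → ℝ) : Prop := ∃ h, IsC1 0 h ∧ IsDualImage A f h

open Classical in
/-- The function `A^* f`, for `f` with `HasDual A f` (and `0` otherwise). -/
def dual {d : ℕ} (A : Op d) (f : E d → ℝ) : E d → ℝ :=
  if h : HasDual A f then h.choose else 0

/-! ### Hypotheses on two-parameter families of operators

The times `s ≤ t` range over a subset `S` of an ordered index set `ι`. -/

/-- `A_{t,t} = Id` and `A_{s,u} A_{u,t} = A_{s,t}` for `s ≤ u ≤ t`, all given by kernels. -/
structure IsSemigroupOn {d : ℕ} {ι : Type} [Preorder ι] (S : Set ι) (A : ι → ι → Op d) :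
    Prop where
  kernel : ∀ s ∈ S, ∀ t ∈ S, s ≤ t → IsKernelOp (A s t)
  refl : ∀ t ∈ S, A t t = 1
  comp : ∀ s ∈ S, ∀ u ∈ S, ∀ t ∈ S, s ≤ u → u ≤ t → A s u * A u t = A s t

/-- Propagation of `C_b^r` regularity, with constant `K r`. -/
def Propagates {d : ℕ} {ι : Type} [Preorder ι] (S : Set ι) (K : ℕ → ℝ) (A : ι → ι → Op d) :
    Prop :=
  ∀ s ∈ S, ∀ t ∈ S, s ≤ t → ∀ (r : ℕ) (f : Mb d), IsCb r (f : E d → ℝ) →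
    IsCb r (A s t f : E d → ℝ) ∧
      normSup r (A s t f : E d → ℝ) ≤ K r * normSup r (f : E d → ℝ)

/-- Propagation of `C_1^r` regularity by the dual operators, with constant `K r`. -/
def PropagatesDual {d : ℕ} {ι : Type} [Preorder ι] (S : Set ι) (K : ℕ → ℝ)
    (A : ι → ι → Op d) : Prop :=
  ∀ s ∈ S, ∀ t ∈ S, s ≤ t → ∀ (r : ℕ) (f : E d → ℝ), IsC1 r f →
    HasDual (A s t) f ∧ IsC1 r (dual (A s t) f) ∧
      normL1 r (dual (A s t) f) ≤ K r * normL1 r f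

/-- The regularization property `R_{q,η}(A)`; `τ t` is the time with index `t`. -/
def Regularizes {d : ℕ} {ι : Type} [Preorder ι] (S : Set ι) (τ : ι → ℝ) (K : ℕ → ℝ)
    (q : ℕ) (η : ℝ) (A : ι → ι → Op d) : Prop :=
  ∀ s ∈ S, ∀ t ∈ S, s < t → ∀ (r : ℕ) (γ : Fin d → ℕ), (∑ i, γ i) + r ≤ q →
    ∀ f g : Mb d, (∀ k, IsCb k (f : E d → ℝ)) → (g : E d → ℝ) = multiD γ (f : E d → ℝ) →
      normSup r (A s t g : E d → ℝ) ≤ K r / (τ t - τ s) ^ η * supNorm (f : E d → ℝ)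

/-- The step `δ_n^l = T / n^l`. -/
def step (T : ℝ) (n l : ℕ) : ℝ := T / (n : ℝ) ^ l

/-- The primal short time estimate on the grid of step `δ_n^l`. The operator `Q j k` stands for
`Q^{δ}_{jδ, kδ}`, `δ = δ_n^l`. -/
def ShortTime {d : ℕ} (T : ℝ) (n l : ℕ) (K : ℕ → ℝ) (α : ℝ) (β : ℕ)
    (P : ℝ → ℝ → Op d) (Q : ℕ → ℕ → Op d) : Prop :=
  ∀ k : ℕ, k + 1 ≤ n ^ l → ∀ (r : ℕ) (f : Mb d), IsCb (β + r) (f : E d → ℝ) →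
    normSup r ((P (k * step T n l) ((k + 1) * step T n l) f : E d → ℝ)
        - (Q k (k + 1) f : E d → ℝ))
      ≤ K r * normSup (β + r) (f : E d → ℝ) * step T n l ^ (α + 1)

/-- The dual short time estimate on the grid of step `δ_n^l`. -/
def ShortTimeDual {d : ℕ} (T : ℝ) (n l : ℕ) (K : ℕ → ℝ) (α : ℝ) (β : ℕ)
    (P : ℝ → ℝ → Op d) (Q : ℕ → ℕ → Op d) : Prop :=
  ∀ k : ℕ, k + 1 ≤ n ^ l → ∀ (r : ℕ) (f : E d → ℝ), IsC1 (β + r) f →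
    normL1 r (dual (P (k * step T n l) ((k + 1) * step T n l)) f - dual (Q k (k + 1)) f)
      ≤ K r * normL1 (β + r) f * step T n l ^ (α + 1)

/-! ### The orders, and the operators of order `ν` -/

/-- `m(l,ν) = ⌈ν / ((1+α) l + α)⌉`. -/
def mOrd (α : ℝ) (l : ℕ) (ν : ℝ) : ℕ := ⌈ν / ((1 + α) * l + α)⌉₊

/-- `q_i(l,ν) = ν + ⌈i - (1+α)(l+1)(i-1)⌉`. -/
def qOrd (α : ℝ) (i l : ℕ) (ν : ℝ) : ℝ :=
  ν + (⌈(i : ℝ) - (1 + α) * (l + 1) * ((i : ℝ) - 1)⌉ : ℤ)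

/-- `l(ν,α) = ⌈ν / α⌉`. -/
def lMax (α ν : ℝ) : ℕ := ⌈ν / α⌉₊

/-- Bound on the number of remaining recursion levels. -/
def depth (α : ℝ) (l : ℕ) (ν : ℝ) : ℕ := ⌈(ν - l - α * (l + 1)) / α⌉₊

theorem depth_lt {α : ℝ} (hα : 0 < α) (l : ℕ) (ν : ℝ) (i : Fin (mOrd α l ν - 1)) :
    depth α (l + 1) (qOrd α (i + 1) l ν) < depth α l ν := by
  have hm : 1 < mOrd α l ν := by have := i.isLt; omega
  have hl : (0 : ℝ) ≤ l := Nat.cast_nonneg l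
  have hi : (0 : ℝ) ≤ (i : ℕ) := Nat.cast_nonneg _
  have hden : 0 < (1 + α) * (l : ℝ) + α := by positivity
  have h1 : (1 : ℝ) < ν / ((1 + α) * l + α) := by
    have := Nat.lt_ceil.mp hm
    simpa using this
  rw [one_lt_div hden] at h1
  have hq : qOrd α (i + 1) l ν ≤ ν + 1 := by
    unfold qOrd
    have : ⌈(((i : ℕ) + 1 : ℕ) : ℝ)
        - (1 + α) * (l + 1) * ((((i : ℕ) + 1 : ℕ) : ℝ) - 1)⌉ ≤ 1 := by
      rw [Int.ceil_le]
      push_cast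
      nlinarith [mul_nonneg hi hl, mul_nonneg hi hα.le, mul_nonneg (mul_nonneg hi hl) hα.le]
    have h2 : ((⌈(((i : ℕ) + 1 : ℕ) : ℝ)
        - (1 + α) * (l + 1) * ((((i : ℕ) + 1 : ℕ) : ℝ) - 1)⌉ : ℤ) : ℝ) ≤ 1 := by
      exact_mod_cast this
    linarith
  have hpos : 0 < (ν - l - α * (l + 1)) / α := div_pos (by nlinarith) hα
  unfold depth
  have hle : (qOrd α (i + 1) l ν - ((l + 1 : ℕ) : ℝ) - α * (((l + 1 : ℕ) : ℝ) + 1)) / α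
      ≤ (ν - l - α * (l + 1)) / α - 1 := by
    rw [div_sub_one hα.ne', div_le_div_iff_of_pos_right hα]
    push_cast
    linarith
  refine (Nat.ceil_mono hle).trans_lt ?_
  rw [Nat.ceil_sub_one]
  exact Nat.sub_lt (Nat.ceil_pos.mpr hpos) one_pos

/-- `κ(l,ν) = max (β m(l,ν)) (max_{1 ≤ i ≤ m(l,ν)-1} i κ(l+1, q_i(l,ν)))`. -/
def kappa (α : ℝ) (hα : 0 < α) (β : ℕ) (l : ℕ) (ν : ℝ) : ℕ :=
  max (β * mOrd α l ν) (Finset.univ.sup fun i : Fin (mOrd α l ν - 1) =>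
    ((i : ℕ) + 1) * kappa α hα β (l + 1) (qOrd α (i + 1) l ν))
termination_by depth α l ν
decreasing_by exact depth_lt hα l ν i

/-- `q_ν = max_{1 ≤ i ≤ m(0,ν)} i max(β, κ(1, q_i(0,ν)))`. -/
def qReg (α : ℝ) (hα : 0 < α) (β : ℕ) (ν : ℝ) : ℕ :=
  (Finset.Icc 1 (mOrd α 0 ν)).sup fun i => i * max β (kappa α hα β 1 (qOrd α i 0 ν))

/-- For `ts = [t_1, …, t_i]` and `s = t_0`, the ordered product
`(∏_{j=1}^i Q_{t_{j-1}, t_j - 1} Λ_{t_j}) Q_{t_i, e}` (times are grid indices). -/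
def chain {d : ℕ} (Q : ℕ → ℕ → Op d) (Λ : ℕ → Op d) (e : ℕ) : ℕ → List ℕ → Op d
  | s, [] => Q s e
  | s, t :: ts => Q s (t - 1) * Λ t * chain Q Λ e t ts

/-- `Qhat α hα n Q l ν k` is the operator `Q̂^{ν,δ}_{t, t+δ}` with `δ = δ_n^l` and `t = k δ`, where
`Q l j k` stands for `Q^{δ_n^l}` between the times `j δ_n^l` and `k δ_n^l`. In the grid of step
`δ_n^{l+1}` the times `t` and `t + δ` have the indices `k n` and `k n + n`; the inner sum runs over
`k n = t_0 < t_1 < ⋯ < t_i ≤ k n + n`, that is, over the `i`-element sets `{t_1, …, t_i}`. -/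
def Qhat {d : ℕ} (α : ℝ) (hα : 0 < α) (n : ℕ) (Q : ℕ → ℕ → ℕ → Op d) (l : ℕ) (ν : ℝ) (k : ℕ) :
    Op d :=
  Q (l + 1) (k * n) (k * n + n) +
    ∑ i : Fin (mOrd α l ν - 1),
      ∑ t ∈ Finset.powersetCard ((i : ℕ) + 1) (Finset.Ioc (k * n) (k * n + n)),
        chain (Q (l + 1))
          (fun u => Qhat α hα n Q (l + 1) (qOrd α (i + 1) l ν) (u - 1) - Q (l + 1) (u - 1) u)
          (k * n + n) (k * n) (t.sort (· ≤ ·))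
termination_by depth α l ν
decreasing_by exact depth_lt hα l ν i

/-- `T(ν) = inf {t ∈ π^{δ_n^1} : t ≥ T (n - m(0,ν)) / (n (m(0,ν) + 1))}`. -/
def Tnu (α T : ℝ) (n : ℕ) (ν : ℝ) : ℝ :=
  sInf {t : ℝ | (∃ k : ℕ, t = k * step T n 1) ∧
    T * ((n : ℝ) - mOrd α 0 ν) / (n * ((mOrd α 0 ν : ℝ) + 1)) ≤ t}

end WeakApprox

end

/-! Algebra. Inserting exact steps of `P` into the scheme `Q` on the grid `l + 1` expands `P` over
one step of the grid `l` into chains: propagators of `Q` interrupted by `i` one-step errors `P - Q`.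
Chains with fewer than `m` errors are kept; the remainder has `m` errors and ends with `P`
(`expansion`). `Qhat` is the same truncated sum, with the unknown errors replaced by computable
corrections of order `q_i` built on finer grids (`error_eq`).

Size. There are at most `n^i` chains with `i` increments, and a one-step error on the grid `l + 1`
has size `n^{-(l+1)(1+α)}`. The remainder is thus of order `n^{-m((1+α)l+α)}`, and replacing errors
by corrections costs `n^{i-q_i-(l+1)(1+α)(i-1)}`. The orders `m` and `q_i` are exactly those making
both at most `n^{-μ}` (`sum_sizes_le`). Induction on `depth` propagates this from the fine grids to
the coarse ones (`exists_errorBound`), with `kappa` counting the derivatives lost.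

Regularity. Every increment loses derivatives, while `f` is merely bounded. On the coarsest grid a
chain with at most `m` increments has, by pigeonhole, a gap of at least `(n-m)/(m+1)` steps
(`hasGap_of_le`), and the propagator over it regularizes. Losses to its left are paid by the
derivatives it produces. For an operator `D` to its right, which loses `b` derivatives, write `⟨∂^ρ
A D f, φ⟩ = ±⟨f, D^* A^* ∂^ρ φ⟩`: the regularization property, read by duality, bounds `A^* ∂^ρ φ`
in the norm `‖·‖_{b,1}` by `‖φ‖_{L^1}`, and `D^*` loses only `b` derivatives in `L^1`
(`isSmoothing_of_regularizes`). Summing over chains gives `error_gainsOrder`.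

Extension. This gives a uniform bound for smooth `f`. At each point the error operator is
integration against a finite signed measure (`IsBPCont.exists_measures`), whose action on bounded
measurable functions is controlled by its action on test functions. The finitely many `n ≤ m`,
allowed only when `η = 0`, are absorbed in the constant. -/

noncomputable section

namespace WeakApprox

open scoped ContDiff
open Filter Topology

/-! ### Test functions -/

/-- Smooth functions with compact support. -/
structure IsTest {d : ℕ} (φ : E d → ℝ) : Prop where
  contDiff : ContDiff ℝ ∞ φ
  hasCompactSupport : HasCompactSupport φ

theorem IsTest.continuous {d : ℕ} {φ : E d → ℝ} (h : IsTest φ) : Continuous φ :=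
  h.contDiff.continuous

theorem IsTest.exists_abs_le {d : ℕ} {φ : E d → ℝ} (h : IsTest φ) : ∃ C, ∀ x, |φ x| ≤ C := by
  obtain ⟨C, hC⟩ := h.continuous.bounded_above_of_compact_support h.hasCompactSupport
  exact ⟨C, fun x => by simpa using hC x⟩

theorem IsTest.integrable {d : ℕ} {φ : E d → ℝ} (h : IsTest φ) (μ : Measure (E d))
    [IsFiniteMeasureOnCompacts μ] : Integrable φ μ :=
  h.continuous.integrable_of_hasCompactSupport h.hasCompactSupport

theorem integrable_of_abs_le {d : ℕ} {f : E d → ℝ} (hf : Measurable f) {C : ℝ}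
    (hC : ∀ x, |f x| ≤ C) (ρ : Measure (E d)) [IsFiniteMeasure ρ] : Integrable f ρ :=
  Integrable.of_bound hf.aestronglyMeasurable C (.of_forall fun x => by simpa using hC x)

/-- Bounded measurable functions are approximated in `L¹` by test functions with almost the same
uniform bound. -/
theorem exists_test_approx {d : ℕ} (ρ : Measure (E d)) [IsFiniteMeasure ρ] {f : E d → ℝ}
    (hf : Measurable f) {C : ℝ} (hC : ∀ x, |f x| ≤ C) {ε : ℝ} (hε : 0 < ε) :
    ∃ φ, IsTest φ ∧ (∀ x, |φ x| ≤ C + ε) ∧ ∫ x, |f x - φ x| ∂ρ ≤ ε := by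
  have hC0 : 0 ≤ C := (abs_nonneg _).trans (hC 0)
  have hfi := integrable_of_abs_le hf hC ρ
  obtain ⟨g, hg1, hg2, hg3, hg4⟩ :=
    hfi.exists_hasCompactSupport_integral_sub_le (half_pos hε)
  -- Clipping to `[-C, C]` restores the uniform bound and can only bring `g` closer to `f`.
  set g' : E d → ℝ := fun x => max (-C) (min (g x) C) with hg'
  have hg'c : Continuous g' := by fun_prop
  have hg'b : ∀ x, |g' x| ≤ C := fun x => by
    rw [abs_le]; refine ⟨le_max_left _ _, max_le (by linarith) (min_le_right _ _)⟩
  have hg's : HasCompactSupport g' := by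
    refine hg1.mono fun x hx => ?_
    simp only [Function.mem_support, hg'] at hx ⊢
    contrapose! hx
    simp [hx, hC0]
  have hclose : ∀ x, |f x - g' x| ≤ |f x - g x| := fun x => by
    have := abs_le.1 (hC x)
    simp only [hg']
    rcases le_total (g x) C with h | h
    · rw [min_eq_left h]
      rcases le_total (-C) (g x) with h' | h'
      · rw [max_eq_right h']
      · rw [max_eq_left h', abs_of_nonneg (by linarith), abs_of_nonneg (by linarith)]; linarith
    · rw [min_eq_right h, max_eq_right (by linarith), abs_of_nonpos (by linarith),
        abs_of_nonpos (by linarith)]; linarith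
  -- The smoothing error is at most `ε` pointwise and `ε / 2` after integration; the `+ 1` covers a
  -- measure of mass zero.
  set δ := min ε (ε / (2 * (ρ.real Set.univ + 1))) with hδ
  have hρ : 0 ≤ ρ.real Set.univ := measureReal_nonneg
  have hδ0 : 0 < δ := lt_min hε (by positivity)
  obtain ⟨φ, hφ1, hφ2, hφ3⟩ := hg'c.exists_contDiff_approx ⊤ (ε := fun _ => δ)
    continuous_const fun _ => hδ0
  have hφ : IsTest φ := ⟨hφ1, hg's.mono hφ3⟩
  have hd : ∀ x, |g' x - φ x| ≤ δ := fun x => by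
    rw [abs_sub_comm]; exact (hφ2 x).le
  refine ⟨φ, hφ, fun x => ?_, ?_⟩
  · have h1 := hd x
    have h2 := hg'b x
    have h3 : |φ x| ≤ |g' x| + |g' x - φ x| := by
      have := abs_sub (g' x) (g' x - φ x)
      simpa using this
    linarith [min_le_left ε (ε / (2 * (ρ.real Set.univ + 1)))]
  · have h_int : Integrable (fun x => |f x - φ x|) ρ := (hfi.sub (hφ.integrable ρ)).abs
    calc ∫ x, |f x - φ x| ∂ρ ≤ ∫ x, (|f x - g x| + δ) ∂ρ := by
          refine integral_mono h_int ((hfi.sub hg4).abs.add (integrable_const _)) fun x => ?_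
          have := abs_sub_le (f x) (g' x) (φ x)
          linarith [hd x, hclose x]
      _ = (∫ x, |f x - g x| ∂ρ) + ρ.real Set.univ * δ := by
          have hfg : Integrable (fun x => |f x - g x|) ρ := (hfi.sub hg4).abs
          rw [integral_add hfg (integrable_const _)]
          simp
      _ ≤ ε / 2 + ε / 2 := by
          refine add_le_add (by simpa using hg2) ?_
          calc ρ.real Set.univ * δ ≤ (ρ.real Set.univ + 1) * (ε / (2 * (ρ.real Set.univ + 1))) :=
                mul_le_mul (by linarith) (min_le_right _ _) hδ0.le (by positivity)
            _ = ε / 2 := by field_simp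
      _ = ε := by ring

/-- A bound of a signed measure on test functions extends to bounded measurable functions. -/
theorem abs_integral_sub_le_of_test {d : ℕ} (μ₁ μ₂ : Measure (E d)) [IsFiniteMeasure μ₁]
    [IsFiniteMeasure μ₂] {M : ℝ} (hM : 0 ≤ M)
    (h : ∀ φ, IsTest φ → ∀ C, (∀ x, |φ x| ≤ C) → |(∫ x, φ x ∂μ₁) - ∫ x, φ x ∂μ₂| ≤ M * C)
    {f : E d → ℝ} (hf : Measurable f) {C : ℝ} (hC : ∀ x, |f x| ≤ C) :
    |(∫ x, f x ∂μ₁) - ∫ x, f x ∂μ₂| ≤ M * C := by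
  refine le_of_forall_pos_le_add fun ε hε => ?_
  set ε' := ε / (M + 1) with hε'
  have hε'0 : 0 < ε' := by positivity
  -- Approximation for the sum of the two measures controls both integrals at once.
  obtain ⟨φ, hφ, hφC, hφi⟩ := exists_test_approx (μ₁ + μ₂) hf hC hε'0
  have hd1 : Integrable (fun x => f x - φ x) μ₁ :=
    (integrable_of_abs_le hf hC μ₁).sub (hφ.integrable μ₁)
  have hd2 : Integrable (fun x => f x - φ x) μ₂ :=
    (integrable_of_abs_le hf hC μ₂).sub (hφ.integrable μ₂)
  rw [integral_add_measure hd1.abs hd2.abs] at hφi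
  have h1 := h φ hφ _ hφC
  have e1 : ∫ x, f x ∂μ₁ = (∫ x, (f x - φ x) ∂μ₁) + ∫ x, φ x ∂μ₁ := by
    rw [integral_sub (integrable_of_abs_le hf hC μ₁) (hφ.integrable μ₁)]; ring
  have e2 : ∫ x, f x ∂μ₂ = (∫ x, (f x - φ x) ∂μ₂) + ∫ x, φ x ∂μ₂ := by
    rw [integral_sub (integrable_of_abs_le hf hC μ₂) (hφ.integrable μ₂)]; ring
  have b1 := abs_le.1 (abs_integral_le_integral_abs (f := fun x => f x - φ x) (μ := μ₁))
  have b2 := abs_le.1 (abs_integral_le_integral_abs (f := fun x => f x - φ x) (μ := μ₂))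
  have b3 := abs_le.1 h1
  have hε'2 : M * ε' + ε' = ε := by rw [hε']; field_simp
  rw [abs_le]
  constructor <;> nlinarith

/-- Duality for the `L¹` norm. -/
theorem integral_abs_le_of_test {d : ℕ} {g : E d → ℝ} (hg : Integrable g) {M : ℝ} (hM : 0 ≤ M)
    (h : ∀ φ, IsTest φ → ∀ C, (∀ x, |φ x| ≤ C) → |∫ x, φ x * g x| ≤ M * C) :
    ∫ x, |g x| ≤ M := by
  wlog hgm : Measurable g generalizing g
  · obtain ⟨g', hg', hae⟩ := hg.aestronglyMeasurable.aemeasurable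
    have := this (hg.congr hae) (fun φ hφ C hC => by
      rw [← integral_congr_ae (hae.mono fun x hx => congrArg (φ x * ·) hx)]
      exact h φ hφ C hC) hg'
    rwa [← integral_congr_ae (hae.mono fun x hx => congrArg abs hx)] at this
  -- Testing with `sign g` would give `∫ |g|` exactly; approximating it in `L¹(|g| dx)` makes `∫ φ
  -- g` close to `∫ |g|`.
  set ρ : Measure (E d) := volume.withDensity fun x => ENNReal.ofReal |g x|
  have hρ : IsFiniteMeasure ρ := isFiniteMeasure_withDensity_ofReal hg.abs.2
  have hs : Measurable fun x => Real.sign (g x) := by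
    unfold Real.sign
    exact Measurable.ite (hgm measurableSet_Iio) measurable_const
      (Measurable.ite (hgm measurableSet_Ioi) measurable_const measurable_const)
  have hsb : ∀ x, |Real.sign (g x)| ≤ 1 := fun x => by
    rcases Real.sign_apply_eq (g x) with h | h | h <;> simp [h]
  refine le_of_forall_pos_le_add fun ε hε => ?_
  set ε' := ε / (M + 1) with hε'
  have hε'0 : 0 < ε' := by positivity
  obtain ⟨φ, hφ, hφC, hφi⟩ := exists_test_approx ρ hs hsb hε'0
  have hw : ∫ x, |Real.sign (g x) - φ x| ∂ρ = ∫ x, |g x| * |Real.sign (g x) - φ x| := by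
    rw [integral_withDensity_eq_integral_toReal_smul (by fun_prop) (by simp)]
    simp
  have hφg : Integrable fun x => φ x * g x :=
    hg.bdd_mul hφ.continuous.aestronglyMeasurable (.of_forall fun x => by
      simpa using hφC x)
  have hsg : ∀ x, Real.sign (g x) * g x = |g x| := fun x => by
    rcases lt_trichotomy (g x) 0 with h | h | h
    · rw [Real.sign_of_neg h, abs_of_neg h]; ring
    · simp [h]
    · rw [Real.sign_of_pos h, abs_of_pos h]; ring
  have e : ∫ x, |g x| = (∫ x, (|g x| - φ x * g x)) + ∫ x, φ x * g x := by
    rw [integral_sub hg.abs hφg]; ring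
  have b : ∫ x, (|g x| - φ x * g x) ≤ ∫ x, |g x| * |Real.sign (g x) - φ x| := by
    refine (le_abs_self _).trans (abs_integral_le_integral_abs.trans (le_of_eq ?_))
    refine integral_congr_ae (.of_forall fun x => ?_)
    simp only
    rw [← hsg, ← sub_mul, abs_mul, mul_comm, hsg]
  have := le_of_abs_le (h φ hφ _ hφC)
  have hε'2 : M * ε' + ε' = ε := by rw [hε']; field_simp
  nlinarith

/-- A pointwise bound of a continuous function from its action on test functions. -/
theorem abs_le_of_test {d : ℕ} {w : E d → ℝ} (hw : Continuous w) {M : ℝ}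
    (h : ∀ φ, IsTest φ → |∫ x, w x * φ x| ≤ M * ∫ x, |φ x|) (x : E d) : |w x| ≤ M := by
  refine le_of_forall_pos_le_add fun ε hε => ?_
  obtain ⟨δ, hδ, hδw⟩ := Metric.continuous_iff.1 hw x ε hε
  -- A bump of mass one near `x` turns the integral bound into a pointwise one, by continuity.
  let b : ContDiffBump x := ⟨δ / 2, δ, by positivity, by linarith⟩
  have hb : IsTest (b.normed volume) := ⟨b.contDiff_normed, b.hasCompactSupport_normed⟩
  have hb1 : ∫ y, b.normed volume y = 1 := b.integral_normed
  have hb0 : ∀ y, 0 ≤ b.normed volume y := fun y => b.nonneg_normed y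
  have h1 := h _ hb
  simp only [abs_of_nonneg (hb0 _), hb1, mul_one] at h1
  have hwb : Integrable fun y => w y * b.normed volume y :=
    (hw.mul hb.continuous).integrable_of_hasCompactSupport hb.hasCompactSupport.mul_left
  have hcb : Integrable fun y => w x * b.normed volume y := (hb.integrable volume).const_mul _
  have e : w x = ∫ y, w x * b.normed volume y := by rw [integral_const_mul, hb1, mul_one]
  have key : |w x - ∫ y, w y * b.normed volume y| ≤ ε := by
    rw [e, ← integral_sub hcb hwb]
    refine abs_integral_le_integral_abs.trans ?_
    calc ∫ y, |w x * b.normed volume y - w y * b.normed volume y|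
        ≤ ∫ y, ε * b.normed volume y := by
          refine integral_mono (hcb.sub hwb).abs ((hb.integrable volume).const_mul _) fun y => ?_
          simp only
          rw [← sub_mul, abs_mul, abs_of_nonneg (hb0 y)]
          by_cases hy : dist y x < δ
          · have := hδw y hy
            rw [Real.dist_eq, abs_sub_comm] at this
            exact mul_le_mul_of_nonneg_right this.le (hb0 y)
          · have : b.normed volume y = 0 := by
              rw [← Function.notMem_support, b.support_normed_eq]
              simpa using hy
            simp [this]
      _ = ε := by rw [integral_const_mul, hb1, mul_one]
  have := abs_sub_abs_le_abs_sub (w x) (∫ y, w y * b.normed volume y)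
  linarith

/-! ### Operators continuous under bounded pointwise convergence -/

/-- `A` is bounded by `c` in the uniform norm and continuous under bounded pointwise
convergence. -/
structure IsBPCont {d : ℕ} (A : Op d) (c : ℝ) : Prop where
  bound : ∀ (f : Mb d) (C : ℝ), (∀ x, |(f : E d → ℝ) x| ≤ C) → ∀ x, |(A f : E d → ℝ) x| ≤ c * C
  tendsto : ∀ (f : ℕ → Mb d) (g : Mb d) (C : ℝ), (∀ k x, |(f k : E d → ℝ) x| ≤ C) →
    (∀ x, Tendsto (fun k => (f k : E d → ℝ) x) atTop (𝓝 ((g : E d → ℝ) x))) →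
    ∀ x, Tendsto (fun k => (A (f k) : E d → ℝ) x) atTop (𝓝 ((A g : E d → ℝ) x))

/-- Continuity under bounded convergence is visibly stable under composition, so products of kernel
operators are handled without composing the kernels themselves. -/
theorem IsBPCont.mul {d : ℕ} {A B : Op d} {a b : ℝ} (hA : IsBPCont A a) (hB : IsBPCont B b) :
    IsBPCont (A * B) (a * b) where
  bound f C hC x := by
    rw [mul_assoc]
    exact hA.bound _ _ (hB.bound f C hC) x
  tendsto f g C hC hf :=
    hA.tendsto _ _ (b * C) (fun k => hB.bound _ C (hC k)) (hB.tendsto f g C hC hf)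

theorem IsBPCont.add {d : ℕ} {A B : Op d} {a b : ℝ} (hA : IsBPCont A a) (hB : IsBPCont B b) :
    IsBPCont (A + B) (a + b) where
  bound f C hC x := by
    rw [add_mul]
    exact (abs_add_le _ _).trans (add_le_add (hA.bound f C hC x) (hB.bound f C hC x))
  tendsto f g C hC hf x := (hA.tendsto f g C hC hf x).add (hB.tendsto f g C hC hf x)

theorem IsBPCont.sub {d : ℕ} {A B : Op d} {a b : ℝ} (hA : IsBPCont A a) (hB : IsBPCont B b) :
    IsBPCont (A - B) (a + b) where
  bound f C hC x := by
    rw [add_mul]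
    exact (abs_sub _ _).trans (add_le_add (hA.bound f C hC x) (hB.bound f C hC x))
  tendsto f g C hC hf x := (hA.tendsto f g C hC hf x).sub (hB.tendsto f g C hC hf x)

theorem IsBPCont.zero {d : ℕ} : IsBPCont (0 : Op d) 0 where
  bound f C hC x := by simp
  tendsto f g C hC hf x := by simp

theorem IsBPCont.sum {d : ℕ} {ι : Type*} (s : Finset ι) {A : ι → Op d} {c : ι → ℝ}
    (h : ∀ i ∈ s, IsBPCont (A i) (c i)) : IsBPCont (∑ i ∈ s, A i) (∑ i ∈ s, c i) := by
  classical
  induction s using Finset.induction_on with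
  | empty => simpa using IsBPCont.zero
  | insert i s his ih =>
    rw [Finset.sum_insert his, Finset.sum_insert his]
    exact (h i (by simp)).add (ih fun j hj => h j (by simp [hj]))

/-- A test function as an element of `Mb d`. -/
def IsTest.toMb {d : ℕ} {φ : E d → ℝ} (h : IsTest φ) : Mb d :=
  ⟨φ, h.continuous.measurable, h.exists_abs_le⟩

/-- A kernel operator bounded on test functions is continuous under bounded convergence. -/
theorem IsKernelOp.isBPCont {d : ℕ} {A : Op d} (hA : IsKernelOp A) {c : ℝ} (hc : 0 ≤ c)
    (h : ∀ f : Mb d, IsTest (f : E d → ℝ) → ∀ C, (∀ x, |(f : E d → ℝ) x| ≤ C) →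
      ∀ x, |(A f : E d → ℝ) x| ≤ c * C) : IsBPCont A c where
  bound f C hC x := by
    obtain ⟨μ₁, μ₂, _, _, hμ⟩ := hA x
    rw [hμ]
    refine abs_integral_sub_le_of_test μ₁ μ₂ hc (fun φ hφ D hD => ?_) f.2.1 hC
    have := h hφ.toMb hφ D hD x
    rwa [hμ] at this
  tendsto f g C hC hf x := by
    obtain ⟨μ₁, μ₂, _, _, hμ⟩ := hA x
    simp only [hμ]
    refine Tendsto.sub ?_ ?_ <;>
    exact tendsto_integral_of_dominated_convergence (fun _ => C)
      (fun k => (f k).2.1.aestronglyMeasurable) (integrable_const _)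
      (fun k => .of_forall fun y => by simpa using hC k y) (.of_forall hf)

/-- The indicator function of a measurable set. -/
def indMb {d : ℕ} {S : Set (E d)} (hS : MeasurableSet S) : Mb d :=
  ⟨S.indicator 1, measurable_one.indicator hS, 1, fun x => by
    by_cases hx : x ∈ S <;> simp [hx]⟩

theorem abs_indMb_le {d : ℕ} {S : Set (E d)} (hS : MeasurableSet S) (x : E d) :
    |(indMb hS : E d → ℝ) x| ≤ 1 := by
  by_cases hx : x ∈ S <;> simp [indMb, hx]

/-- A simple function as an element of `Mb d`. -/
def simpleMb {d : ℕ} (u : SimpleFunc (E d) ℝ) : Mb d :=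
  ⟨u, u.measurable, by
    obtain ⟨C, hC⟩ := u.exists_forall_norm_le
    exact ⟨C, fun x => by simpa using hC x⟩⟩

open Classical in
/-- The signed measure `S ↦ A 1_S (x)`. -/
def IsBPCont.signedMeasure {d : ℕ} {A : Op d} {c : ℝ} (hA : IsBPCont A c) (x : E d) :
    SignedMeasure (E d) where
  measureOf' S := if hS : MeasurableSet S then (A (indMb hS) : E d → ℝ) x else 0
  empty' := by
    have : indMb (MeasurableSet.empty : MeasurableSet (∅ : Set (E d))) = 0 := by
      ext; simp [indMb]
    simp [this]
  not_measurable' S hS := by simp [hS]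
  m_iUnion' F hF hdis := by
    have hU : MeasurableSet (⋃ i, F i) := MeasurableSet.iUnion hF
    simp only [hF, hU, dif_pos]
    have hb : ∀ u : Finset ℕ, MeasurableSet (⋃ i ∈ u, F i) := fun u =>
      Finset.measurableSet_biUnion u fun i _ => hF i
    have hs : ∀ u : Finset ℕ, ∑ i ∈ u, (A (indMb (hF i)) : E d → ℝ) x
        = (A (indMb (hb u)) : E d → ℝ) x := fun u => by
      have : indMb (hb u) = ∑ i ∈ u, indMb (hF i) := by
        ext y
        simp only [indMb, Submodule.coe_sum, Finset.sum_apply]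
        rw [Finset.indicator_biUnion_apply]
        exact fun i _ j _ hij => hdis hij
      rw [this, map_sum]
      simp
    unfold HasSum
    simp only [hs]
    -- Bounded convergence is available for sequences only; the filter of finite subsets of `ℕ` is
    -- countably generated, so sequences suffice.
    refine tendsto_of_seq_tendsto fun u hu => ?_
    refine hA.tendsto _ _ 1 (fun k y => abs_indMb_le _ y) (fun y => ?_) x
    by_cases hy : y ∈ ⋃ i, F i
    · obtain ⟨i, hi⟩ := Set.mem_iUnion.1 hy
      refine tendsto_const_nhds.congr' ?_
      filter_upwards [hu.eventually (eventually_ge_atTop {i})] with k hk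
      have : y ∈ ⋃ i ∈ u k, F i := by
        simp only [Set.mem_iUnion]
        exact ⟨i, hk (by simp), hi⟩
      simp [indMb, hy, this]
    · refine tendsto_const_nhds.congr fun k => ?_
      have : y ∉ ⋃ i ∈ u k, F i := by
        simp only [Set.mem_iUnion, not_exists] at hy ⊢
        exact fun i _ => hy i
      simp [indMb, hy, this]

theorem IsBPCont.signedMeasure_apply {d : ℕ} {A : Op d} {c : ℝ} (hA : IsBPCont A c) (x : E d)
    {S : Set (E d)} (hS : MeasurableSet S) :
    hA.signedMeasure x S = (A (indMb hS) : E d → ℝ) x :=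
  dif_pos hS

/-- Continuity under bounded convergence is countable additivity of `S ↦ A 1_S (x)`. The Jordan
decomposition of this signed measure represents `A` on indicators, hence on simple functions, hence
on their bounded limits. -/
theorem IsBPCont.exists_measures {d : ℕ} {A : Op d} {c : ℝ} (hA : IsBPCont A c) (x : E d) :
    ∃ μ₁ μ₂ : Measure (E d), IsFiniteMeasure μ₁ ∧ IsFiniteMeasure μ₂ ∧
      ∀ f : Mb d, (A f : E d → ℝ) x
        = (∫ y, (f : E d → ℝ) y ∂μ₁) - ∫ y, (f : E d → ℝ) y ∂μ₂ := by
  set j := (hA.signedMeasure x).toJordanDecomposition with hj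
  refine ⟨j.posPart, j.negPart, inferInstance, inferInstance, ?_⟩
  have hset : ∀ (S : Set (E d)) (hS : MeasurableSet S),
      (A (indMb hS) : E d → ℝ) x = j.posPart.real S - j.negPart.real S := fun S hS => by
    rw [← hA.signedMeasure_apply x hS, ← (hA.signedMeasure x).toSignedMeasure_toJordanDecomposition,
      JordanDecomposition.toSignedMeasure, sub_apply,
      Measure.toSignedMeasure_apply_measurable hS, Measure.toSignedMeasure_apply_measurable hS]
  have hsimple : ∀ u : SimpleFunc (E d) ℝ, (A (simpleMb u) : E d → ℝ) x
      = (∫ y, u y ∂j.posPart) - ∫ y, u y ∂j.negPart := fun u => by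
    induction u using SimpleFunc.induction with
    | const a hS =>
      rename_i S
      have e : simpleMb (SimpleFunc.piecewise S hS (SimpleFunc.const _ a) (SimpleFunc.const _ 0))
          = a • indMb hS := by
        ext y
        by_cases hy : y ∈ S <;> simp [simpleMb, indMb, hy]
      have e2 : ∀ y, (SimpleFunc.piecewise S hS (SimpleFunc.const _ a) (SimpleFunc.const _ 0)) y
          = S.indicator (fun _ => a) y := fun y => by
        by_cases hy : y ∈ S <;> simp [hy]
      rw [e, map_smul]
      simp only [e2, integral_indicator_const a hS]
      simp only [Submodule.coe_smul, Pi.smul_apply, hset, smul_eq_mul]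
      ring
    | add hfg hf hg =>
      rename_i f g
      have e : simpleMb (f + g) = simpleMb f + simpleMb g := rfl
      rw [e, map_add]
      have hi : ∀ (u : SimpleFunc (E d) ℝ) (μ : Measure (E d)) [IsFiniteMeasure μ],
        Integrable u μ := fun u μ _ => u.integrable_of_isFiniteMeasure
      simp only [SimpleFunc.coe_add, Pi.add_apply]
      rw [integral_add (hi f _) (hi g _), integral_add (hi f _) (hi g _)]
      simp only [Submodule.coe_add, Pi.add_apply, hf, hg]
      ring
  intro f
  obtain ⟨C, hC⟩ := f.2.2
  let u : ℕ → SimpleFunc (E d) ℝ :=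
    SimpleFunc.approxOn (f : E d → ℝ) f.2.1 Set.univ 0 (by simp)
  have hub : ∀ k y, |u k y| ≤ C + C := fun k y => by
    have := SimpleFunc.norm_approxOn_zero_le f.2.1 (s := Set.univ) (by simp) y k
    simp only [Real.norm_eq_abs] at this
    exact this.trans (add_le_add (hC y) (hC y))
  have hut : ∀ y, Tendsto (fun k => u k y) atTop (𝓝 ((f : E d → ℝ) y)) := fun y =>
    SimpleFunc.tendsto_approxOn f.2.1 (by simp) (by simp)
  refine tendsto_nhds_unique (hA.tendsto (fun k => simpleMb (u k)) f (C + C) hub hut x) ?_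
  simp only [hsimple]
  refine Tendsto.sub ?_ ?_ <;>
  exact tendsto_integral_of_dominated_convergence (fun _ => C + C)
    (fun k => (u k).measurable.aestronglyMeasurable) (integrable_const _)
    (fun k => .of_forall fun y => by simpa using hub k y) (.of_forall hut)

/-- For an operator continuous under bounded convergence, bounds on test functions extend to all
bounded measurable functions. -/
theorem IsBPCont.abs_le_of_test {d : ℕ} {A : Op d} {c : ℝ} (hA : IsBPCont A c) {M : ℝ}
    (hM : 0 ≤ M) (x : E d)
    (h : ∀ f : Mb d, IsTest (f : E d → ℝ) → ∀ C, (∀ y, |(f : E d → ℝ) y| ≤ C) →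
      |(A f : E d → ℝ) x| ≤ M * C)
    (f : Mb d) {C : ℝ} (hC : ∀ y, |(f : E d → ℝ) y| ≤ C) : |(A f : E d → ℝ) x| ≤ M * C := by
  obtain ⟨μ₁, μ₂, _, _, hμ⟩ := hA.exists_measures x
  rw [hμ]
  refine abs_integral_sub_le_of_test μ₁ μ₂ hM (fun φ hφ D hD => ?_) f.2.1 hC
  have := h hφ.toMb hφ D hD
  rwa [hμ] at this

/-! ### Calculus of iterated partial derivatives -/

theorem contDiff_partialD {d : ℕ} {f : E d → ℝ} (hf : ContDiff ℝ ∞ f) (i : Fin d) :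
    ContDiff ℝ ∞ (partialD i f) :=
  (hf.fderiv_right (m := ∞) le_rfl).clm_apply contDiff_const

theorem contDiff_iterPartial {d : ℕ} {f : E d → ℝ} (hf : ContDiff ℝ ∞ f) (w : List (Fin d)) :
    ContDiff ℝ ∞ (iterPartial w f) := by
  induction w with
  | nil => exact hf
  | cons i w ih => exact contDiff_partialD ih i

theorem differentiable_of_smooth {d : ℕ} {f : E d → ℝ} (hf : ContDiff ℝ ∞ f) :
    Differentiable ℝ f := hf.differentiable (by simp)

theorem iterPartial_add {d : ℕ} {f g : E d → ℝ} (hf : ContDiff ℝ ∞ f) (hg : ContDiff ℝ ∞ g)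
    (w : List (Fin d)) : iterPartial w (f + g) = iterPartial w f + iterPartial w g := by
  induction w with
  | nil => rfl
  | cons i w ih =>
    ext x
    simp only [iterPartial, partialD, ih, Pi.add_apply]
    rw [fderiv_add (differentiable_of_smooth (contDiff_iterPartial hf w) x)
      (differentiable_of_smooth (contDiff_iterPartial hg w) x)]
    rfl

theorem iterPartial_sub {d : ℕ} {f g : E d → ℝ} (hf : ContDiff ℝ ∞ f) (hg : ContDiff ℝ ∞ g)
    (w : List (Fin d)) : iterPartial w (f - g) = iterPartial w f - iterPartial w g := by
  induction w with
  | nil => rfl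
  | cons i w ih =>
    ext x
    simp only [iterPartial, partialD, ih, Pi.sub_apply]
    rw [fderiv_sub (differentiable_of_smooth (contDiff_iterPartial hf w) x)
      (differentiable_of_smooth (contDiff_iterPartial hg w) x)]
    rfl

theorem iterPartial_append {d : ℕ} (w w' : List (Fin d)) (f : E d → ℝ) :
    iterPartial (w ++ w') f = iterPartial w (iterPartial w' f) := by
  induction w with
  | nil => rfl
  | cons i w ih => simp only [List.cons_append, iterPartial, ih]

theorem partialD_comm {d : ℕ} {f : E d → ℝ} (hf : ContDiff ℝ ∞ f) (i j : Fin d) :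
    partialD i (partialD j f) = partialD j (partialD i f) := by
  have key : ∀ (v u : E d) (x : E d),
      fderiv ℝ (fun y => fderiv ℝ f y v) x u = fderiv ℝ (fderiv ℝ f) x u v := fun v u x => by
    have hd : DifferentiableAt ℝ (fderiv ℝ f) x :=
      (hf.fderiv_right (m := ∞) le_rfl).differentiable (by simp) x
    rw [fderiv_clm_apply hd (differentiableAt_const v)]
    simp
  ext x
  exact (key _ _ x).trans (((hf.contDiffAt.isSymmSndFDerivAt (by
    simpa using ENat.LEInfty.out)) _ _).trans
    (key _ _ x).symm)

theorem iterPartial_perm {d : ℕ} {f : E d → ℝ} (hf : ContDiff ℝ ∞ f) {w w' : List (Fin d)}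
    (h : w.Perm w') : iterPartial w f = iterPartial w' f := by
  induction h with
  | nil => rfl
  | cons i _ ih => simp only [iterPartial, ih]
  | swap i j w => exact partialD_comm (contDiff_iterPartial hf w) j i
  | trans _ _ ih1 ih2 => exact ih1.trans ih2

theorem IsTest.partialD {d : ℕ} {φ : E d → ℝ} (h : IsTest φ) (i : Fin d) :
    IsTest (partialD i φ) :=
  ⟨contDiff_partialD h.contDiff i, h.hasCompactSupport.fderiv_apply ℝ _⟩

theorem IsTest.iterPartial {d : ℕ} {φ : E d → ℝ} (h : IsTest φ) (w : List (Fin d)) :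
    IsTest (iterPartial w φ) := by
  induction w with
  | nil => exact h
  | cons i w ih => exact ih.partialD i

theorem integrable_mul_test {d : ℕ} {u φ : E d → ℝ} (hu : Continuous u) (hφ : IsTest φ) :
    Integrable fun x => u x * φ x :=
  (hu.mul hφ.continuous).integrable_of_hasCompactSupport hφ.hasCompactSupport.mul_left

theorem integral_partialD_mul {d : ℕ} {u φ : E d → ℝ} (hu : ContDiff ℝ ∞ u) (hφ : IsTest φ)
    (i : Fin d) : ∫ x, partialD i u x * φ x = -∫ x, u x * partialD i φ x := by
  have := integral_mul_fderiv_eq_neg_fderiv_mul_of_integrable (μ := (volume : Measure (E d)))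
    (f := u) (g := φ) (v := EuclideanSpace.single i (1 : ℝ))
    (integrable_mul_test (contDiff_partialD hu i).continuous hφ)
    (integrable_mul_test hu.continuous (hφ.partialD i))
    (integrable_mul_test hu.continuous hφ) (fun x _ => differentiable_of_smooth hu x)
    (fun x _ => differentiable_of_smooth hφ.contDiff x)
  simp only [partialD]
  rw [this, neg_neg]

/-- Repeated integration by parts moves the derivatives in reverse order; the absolute values
dispense with tracking the sign `(-1)^{|w|}`. -/
theorem abs_integral_iterPartial_mul {d : ℕ} {u φ : E d → ℝ} (hu : ContDiff ℝ ∞ u)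
    (hφ : IsTest φ) (w : List (Fin d)) :
    |∫ x, iterPartial w u x * φ x| = |∫ x, u x * iterPartial w.reverse φ x| := by
  induction w generalizing φ with
  | nil => rfl
  | cons i w ih =>
    rw [List.reverse_cons, iterPartial_append]
    simp only [iterPartial]
    rw [integral_partialD_mul (contDiff_iterPartial hu w) hφ, abs_neg, ih (hφ.partialD i)]

/-! ### Multi-indices and norms -/

theorem mem_multiIdx {d r : ℕ} {γ : Fin d → ℕ} : γ ∈ multiIdx d r ↔ ∑ i, γ i ≤ r := by
  simp only [multiIdx, Finset.mem_filter, Fintype.mem_piFinset, Finset.mem_range,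
    and_iff_right_iff_imp]
  intro h i
  have := Finset.single_le_sum (f := γ) (fun j _ => Nat.zero_le _) (Finset.mem_univ i)
  omega

theorem multiIdx_mono {d r r' : ℕ} (h : r ≤ r') : multiIdx d r ⊆ multiIdx d r' := fun γ hγ => by
  rw [mem_multiIdx] at *; omega

theorem zero_mem_multiIdx (d r : ℕ) : (0 : Fin d → ℕ) ∈ multiIdx d r := by simp [mem_multiIdx]

theorem multiD_zero {d : ℕ} (f : E d → ℝ) : multiD 0 f = f := by
  have : ((List.finRange d).flatMap fun i => List.replicate ((0 : Fin d → ℕ) i) i) = [] := by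
    simp
  rw [multiD, this, iterPartial]

theorem multiD_add {d : ℕ} {f g : E d → ℝ} (hf : ContDiff ℝ ∞ f) (hg : ContDiff ℝ ∞ g)
    (γ : Fin d → ℕ) : multiD γ (f + g) = multiD γ f + multiD γ g := iterPartial_add hf hg _

theorem multiD_sub {d : ℕ} {f g : E d → ℝ} (hf : ContDiff ℝ ∞ f) (hg : ContDiff ℝ ∞ g)
    (γ : Fin d → ℕ) : multiD γ (f - g) = multiD γ f - multiD γ g := iterPartial_sub hf hg _

theorem contDiff_multiD {d : ℕ} {f : E d → ℝ} (hf : ContDiff ℝ ∞ f) (γ : Fin d → ℕ) :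
    ContDiff ℝ ∞ (multiD γ f) := contDiff_iterPartial hf _

theorem IsTest.multiD {d : ℕ} {φ : E d → ℝ} (h : IsTest φ) (γ : Fin d → ℕ) :
    IsTest (multiD γ φ) := h.iterPartial _

theorem supNorm_nonneg {d : ℕ} (f : E d → ℝ) : 0 ≤ supNorm f :=
  Real.iSup_nonneg fun _ => abs_nonneg _

theorem supNorm_le {d : ℕ} {f : E d → ℝ} {C : ℝ} (h : ∀ x, |f x| ≤ C) : supNorm f ≤ C :=
  ciSup_le h

theorem abs_le_supNorm {d : ℕ} {f : E d → ℝ} {C : ℝ} (h : ∀ x, |f x| ≤ C) (x : E d) :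
    |f x| ≤ supNorm f :=
  le_ciSup (f := fun x => |f x|) ⟨C, by rintro _ ⟨y, rfl⟩; exact h y⟩ x

theorem Mb.abs_le_supNorm {d : ℕ} (f : Mb d) (x : E d) :
    |(f : E d → ℝ) x| ≤ supNorm (f : E d → ℝ) :=
  WeakApprox.abs_le_supNorm f.2.2.choose_spec x

theorem normSup_nonneg {d : ℕ} (r : ℕ) (f : E d → ℝ) : 0 ≤ normSup r f :=
  Finset.sum_nonneg fun _ _ => supNorm_nonneg _

theorem normSup_mono {d r r' : ℕ} (h : r ≤ r') (f : E d → ℝ) : normSup r f ≤ normSup r' f :=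
  Finset.sum_le_sum_of_subset_of_nonneg (multiIdx_mono h) fun _ _ _ => supNorm_nonneg _

theorem supNorm_multiD_le_normSup {d r : ℕ} {γ : Fin d → ℕ} (h : γ ∈ multiIdx d r)
    (f : E d → ℝ) : supNorm (multiD γ f) ≤ normSup r f :=
  Finset.single_le_sum (f := fun γ => supNorm (multiD γ f)) (fun _ _ => supNorm_nonneg _) h

theorem normSup_zero {d : ℕ} (f : E d → ℝ) : normSup 0 f = supNorm f := by
  have : multiIdx d 0 = {0} := by
    ext γ; simp [mem_multiIdx, funext_iff]
  rw [normSup, this, Finset.sum_singleton, multiD_zero]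

theorem normL1_nonneg {d : ℕ} (r : ℕ) (f : E d → ℝ) : 0 ≤ normL1 r f :=
  Finset.sum_nonneg fun _ _ => integral_nonneg fun _ => abs_nonneg _

theorem normL1_mono {d r r' : ℕ} (h : r ≤ r') (f : E d → ℝ) : normL1 r f ≤ normL1 r' f :=
  Finset.sum_le_sum_of_subset_of_nonneg (multiIdx_mono h)
    fun _ _ _ => integral_nonneg fun _ => abs_nonneg _

theorem integral_abs_le_normL1 {d : ℕ} (r : ℕ) (f : E d → ℝ) : ∫ x, |f x| ≤ normL1 r f := by
  have := Finset.single_le_sum (f := fun γ => ∫ x, |multiD γ f x|)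
    (fun _ _ => integral_nonneg fun _ => abs_nonneg _) (zero_mem_multiIdx d r)
  simp only [multiD_zero] at this
  exact this

/-! ### Smooth functions with bounded, or integrable, derivatives of all orders -/

/-- `f ∈ C_b^∞`. -/
def IsSmoothCb {d : ℕ} (f : E d → ℝ) : Prop := ∀ k, IsCb k f

/-- `f ∈ C_1^∞`. -/
def IsSmoothC1 {d : ℕ} (f : E d → ℝ) : Prop := ∀ k, IsC1 k f

/-- With all orders allowed, the condition `|γ| ≤ k` disappears: each `γ` is reached at `k = |γ|`.
-/
theorem isSmoothCb_iff {d : ℕ} {f : E d → ℝ} :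
    IsSmoothCb f ↔ ContDiff ℝ ∞ f ∧ ∀ γ, ∃ C : ℝ, ∀ x, |multiD γ f x| ≤ C :=
  ⟨fun h => ⟨contDiff_infty.2 fun k => (h k).1, fun γ => (h (∑ i, γ i)).2 γ (by
    rw [mem_multiIdx])⟩, fun h k => ⟨contDiff_infty.1 h.1 k, fun γ _ => h.2 γ⟩⟩

theorem isSmoothC1_iff {d : ℕ} {f : E d → ℝ} :
    IsSmoothC1 f ↔ ContDiff ℝ ∞ f ∧ ∀ γ, Integrable (multiD γ f) :=
  ⟨fun h => ⟨contDiff_infty.2 fun k => (h k).1, fun γ => (h (∑ i, γ i)).2 γ (by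
    rw [mem_multiIdx])⟩, fun h k => ⟨contDiff_infty.1 h.1 k, fun γ _ => h.2 γ⟩⟩

theorem IsSmoothCb.contDiff {d : ℕ} {f : E d → ℝ} (h : IsSmoothCb f) : ContDiff ℝ ∞ f :=
  (isSmoothCb_iff.1 h).1

theorem IsSmoothC1.contDiff {d : ℕ} {f : E d → ℝ} (h : IsSmoothC1 f) : ContDiff ℝ ∞ f :=
  (isSmoothC1_iff.1 h).1

theorem IsSmoothC1.integrable {d : ℕ} {f : E d → ℝ} (h : IsSmoothC1 f) : Integrable f := by
  simpa only [multiD_zero] using (isSmoothC1_iff.1 h).2 0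

theorem IsSmoothCb.add {d : ℕ} {f g : E d → ℝ} (hf : IsSmoothCb f) (hg : IsSmoothCb g) :
    IsSmoothCb (f + g) := by
  rw [isSmoothCb_iff] at *
  refine ⟨hf.1.add hg.1, fun γ => ?_⟩
  obtain ⟨C, hC⟩ := hf.2 γ
  obtain ⟨D, hD⟩ := hg.2 γ
  rw [multiD_add hf.1 hg.1]
  exact ⟨C + D, fun x => (abs_add_le _ _).trans (add_le_add (hC x) (hD x))⟩

theorem IsSmoothCb.sub {d : ℕ} {f g : E d → ℝ} (hf : IsSmoothCb f) (hg : IsSmoothCb g) :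
    IsSmoothCb (f - g) := by
  rw [isSmoothCb_iff] at *
  refine ⟨hf.1.sub hg.1, fun γ => ?_⟩
  obtain ⟨C, hC⟩ := hf.2 γ
  obtain ⟨D, hD⟩ := hg.2 γ
  rw [multiD_sub hf.1 hg.1]
  exact ⟨C + D, fun x => (abs_sub _ _).trans (add_le_add (hC x) (hD x))⟩

theorem normSup_add_le {d r : ℕ} {f g : E d → ℝ} (hf : IsSmoothCb f) (hg : IsSmoothCb g) :
    normSup r (f + g) ≤ normSup r f + normSup r g := by
  rw [normSup, normSup, normSup, ← Finset.sum_add_distrib]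
  refine Finset.sum_le_sum fun γ _ => supNorm_le fun x => ?_
  obtain ⟨C, hC⟩ := (isSmoothCb_iff.1 hf).2 γ
  obtain ⟨D, hD⟩ := (isSmoothCb_iff.1 hg).2 γ
  rw [multiD_add hf.contDiff hg.contDiff]
  exact (abs_add_le _ _).trans (add_le_add (abs_le_supNorm hC x) (abs_le_supNorm hD x))

theorem normSup_sub_le {d r : ℕ} {f g : E d → ℝ} (hf : IsSmoothCb f) (hg : IsSmoothCb g) :
    normSup r (f - g) ≤ normSup r f + normSup r g := by
  rw [normSup, normSup, normSup, ← Finset.sum_add_distrib]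
  refine Finset.sum_le_sum fun γ _ => supNorm_le fun x => ?_
  obtain ⟨C, hC⟩ := (isSmoothCb_iff.1 hf).2 γ
  obtain ⟨D, hD⟩ := (isSmoothCb_iff.1 hg).2 γ
  rw [multiD_sub hf.contDiff hg.contDiff]
  exact (abs_sub _ _).trans (add_le_add (abs_le_supNorm hC x) (abs_le_supNorm hD x))

theorem IsSmoothC1.add {d : ℕ} {f g : E d → ℝ} (hf : IsSmoothC1 f) (hg : IsSmoothC1 g) :
    IsSmoothC1 (f + g) := by
  rw [isSmoothC1_iff] at *
  refine ⟨hf.1.add hg.1, fun γ => ?_⟩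
  rw [multiD_add hf.1 hg.1]
  exact (hf.2 γ).add (hg.2 γ)

theorem IsSmoothC1.sub {d : ℕ} {f g : E d → ℝ} (hf : IsSmoothC1 f) (hg : IsSmoothC1 g) :
    IsSmoothC1 (f - g) := by
  rw [isSmoothC1_iff] at *
  refine ⟨hf.1.sub hg.1, fun γ => ?_⟩
  rw [multiD_sub hf.1 hg.1]
  exact (hf.2 γ).sub (hg.2 γ)

theorem normL1_add_le {d r : ℕ} {f g : E d → ℝ} (hf : IsSmoothC1 f) (hg : IsSmoothC1 g) :
    normL1 r (f + g) ≤ normL1 r f + normL1 r g := by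
  rw [normL1, normL1, normL1, ← Finset.sum_add_distrib]
  refine Finset.sum_le_sum fun γ _ => ?_
  have h1 := (isSmoothC1_iff.1 hf).2 γ
  have h2 := (isSmoothC1_iff.1 hg).2 γ
  rw [multiD_add hf.contDiff hg.contDiff, ← integral_add h1.abs h2.abs]
  exact integral_mono (h1.add h2).abs (h1.abs.add h2.abs) fun x => abs_add_le _ _

theorem normL1_sub_le {d r : ℕ} {f g : E d → ℝ} (hf : IsSmoothC1 f) (hg : IsSmoothC1 g) :
    normL1 r (f - g) ≤ normL1 r f + normL1 r g := by
  rw [normL1, normL1, normL1, ← Finset.sum_add_distrib]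
  refine Finset.sum_le_sum fun γ _ => ?_
  have h1 := (isSmoothC1_iff.1 hf).2 γ
  have h2 := (isSmoothC1_iff.1 hg).2 γ
  rw [multiD_sub hf.contDiff hg.contDiff, ← integral_add h1.abs h2.abs]
  exact integral_mono (h1.sub h2).abs (h1.abs.add h2.abs) fun x => abs_sub _ _

theorem IsTest.isSmoothCb {d : ℕ} {φ : E d → ℝ} (h : IsTest φ) : IsSmoothCb φ :=
  isSmoothCb_iff.2 ⟨h.contDiff, fun γ => (h.multiD γ).exists_abs_le⟩

theorem IsTest.isSmoothC1 {d : ℕ} {φ : E d → ℝ} (h : IsTest φ) : IsSmoothC1 φ :=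
  isSmoothC1_iff.2 ⟨h.contDiff, fun γ => (h.multiD γ).integrable volume⟩

/-! ### Operators losing a given number of derivatives -/

theorem integrable_Mb_mul {d : ℕ} (g : Mb d) {ψ : E d → ℝ} (hψ : Integrable ψ) :
    Integrable fun x => (g : E d → ℝ) x * ψ x :=
  hψ.bdd_mul g.2.1.aestronglyMeasurable
    (.of_forall fun x => by simpa using g.2.2.choose_spec x)

/-- `A` and its dual lose at most `a` derivatives, with constant `M`, in the range of orders of
differentiation bounded by `R`. -/
structure HasOrder {d : ℕ} (R : ℕ) (A : Op d) (a : ℕ) (M : ℝ) : Prop where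
  mem : ∀ f : Mb d, IsSmoothCb (f : E d → ℝ) → IsSmoothCb (A f : E d → ℝ)
  le : ∀ f : Mb d, IsSmoothCb (f : E d → ℝ) → ∀ r, a + r ≤ R →
    normSup r (A f : E d → ℝ) ≤ M * normSup (a + r) (f : E d → ℝ)
  dual : ∀ ψ : E d → ℝ, IsSmoothC1 ψ → ∃ h, IsSmoothC1 h ∧ IsDualImage A ψ h ∧
    ∀ r, a + r ≤ R → normL1 r h ≤ M * normL1 (a + r) ψ

theorem HasOrder.mono {d R a a' : ℕ} {A : Op d} {M M' : ℝ} (h : HasOrder R A a M) (ha : a ≤ a')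
    (hM : M ≤ M') (hM' : 0 ≤ M') : HasOrder R A a' M' where
  mem := h.mem
  le f hf r hr := (h.le f hf r (by omega)).trans
    (mul_le_mul hM (normSup_mono (by omega) _) (normSup_nonneg _ _) hM')
  dual ψ hψ := by
    obtain ⟨g, hg, hd, hl⟩ := h.dual ψ hψ
    exact ⟨g, hg, hd, fun r hr => (hl r (by omega)).trans
      (mul_le_mul hM (normL1_mono (by omega) _) (normL1_nonneg _ _) hM')⟩

theorem HasOrder.one {d : ℕ} (R : ℕ) : HasOrder R (1 : Op d) 0 1 where
  mem f hf := hf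
  le f hf r hr := by simp
  dual ψ hψ := ⟨ψ, hψ, fun g => rfl, fun r hr => by simp⟩

theorem multiD_zero_fun {d : ℕ} (γ : Fin d → ℕ) : multiD γ (0 : E d → ℝ) = 0 := by
  have h := multiD_sub (f := (0 : E d → ℝ)) (g := 0) contDiff_const contDiff_const γ
  simpa using h

theorem normL1_zero_fun {d : ℕ} (r : ℕ) : normL1 r (0 : E d → ℝ) = 0 := by
  simp [normL1, multiD_zero_fun]

theorem normSup_zero_fun {d : ℕ} (r : ℕ) : normSup r (0 : E d → ℝ) = 0 := by
  simp [normSup, multiD_zero_fun, supNorm]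

theorem isTest_zero {d : ℕ} : IsTest (0 : E d → ℝ) := ⟨contDiff_const, HasCompactSupport.zero⟩

theorem HasOrder.zero {d : ℕ} (R a : ℕ) {M : ℝ} (hM : 0 ≤ M) : HasOrder R (0 : Op d) a M where
  mem f hf := isTest_zero.isSmoothCb
  le f hf r hr := by
    have : ((0 : Op d) f : E d → ℝ) = 0 := rfl
    rw [this, normSup_zero_fun]
    exact mul_nonneg hM (normSup_nonneg _ _)
  dual ψ hψ := ⟨0, isTest_zero.isSmoothC1, fun g => by simp, fun r hr => by
    rw [normL1_zero_fun]
    exact mul_nonneg hM (normL1_nonneg _ _)⟩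

theorem HasOrder.add {d R a : ℕ} {A B : Op d} {M M' : ℝ} (hA : HasOrder R A a M)
    (hB : HasOrder R B a M') : HasOrder R (A + B) a (M + M') where
  mem f hf := (hA.mem f hf).add (hB.mem f hf)
  le f hf r hr := by
    rw [add_mul]
    exact (normSup_add_le (hA.mem f hf) (hB.mem f hf)).trans
      (add_le_add (hA.le f hf r hr) (hB.le f hf r hr))
  dual ψ hψ := by
    obtain ⟨g, hg, hgd, hgl⟩ := hA.dual ψ hψ
    obtain ⟨h, hh, hhd, hhl⟩ := hB.dual ψ hψ
    refine ⟨g + h, hg.add hh, fun f => ?_, fun r hr => ?_⟩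
    · have e1 : ∀ x, ((A + B) f : E d → ℝ) x * ψ x
          = (A f : E d → ℝ) x * ψ x + (B f : E d → ℝ) x * ψ x := fun x => add_mul _ _ _
      have e2 : ∀ x, (f : E d → ℝ) x * (g + h) x
          = (f : E d → ℝ) x * g x + (f : E d → ℝ) x * h x := fun x => mul_add _ _ _
      simp only [e1, e2]
      rw [integral_add (integrable_Mb_mul _ hψ.integrable) (integrable_Mb_mul _ hψ.integrable),
        integral_add (integrable_Mb_mul _ hg.integrable) (integrable_Mb_mul _ hh.integrable),
        hgd, hhd]
    · rw [add_mul]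
      exact (normL1_add_le hg hh).trans (add_le_add (hgl r hr) (hhl r hr))

theorem IsDualImage.sub {d : ℕ} {A B : Op d} {ψ g h : E d → ℝ} (hψ : Integrable ψ)
    (hg : Integrable g) (hh : Integrable h) (hA : IsDualImage A ψ g) (hB : IsDualImage B ψ h) :
    IsDualImage (A - B) ψ (g - h) := fun f => by
  have e1 : ∀ x, ((A - B) f : E d → ℝ) x * ψ x
      = (A f : E d → ℝ) x * ψ x - (B f : E d → ℝ) x * ψ x := fun x => sub_mul _ _ _
  have e2 : ∀ x, (f : E d → ℝ) x * (g - h) x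
      = (f : E d → ℝ) x * g x - (f : E d → ℝ) x * h x := fun x => mul_sub _ _ _
  simp only [e1, e2]
  rw [integral_sub (integrable_Mb_mul _ hψ) (integrable_Mb_mul _ hψ),
    integral_sub (integrable_Mb_mul _ hg) (integrable_Mb_mul _ hh), hA, hB]

theorem HasOrder.sub {d R a : ℕ} {A B : Op d} {M M' : ℝ} (hA : HasOrder R A a M)
    (hB : HasOrder R B a M') : HasOrder R (A - B) a (M + M') where
  mem f hf := (hA.mem f hf).sub (hB.mem f hf)
  le f hf r hr := by
    rw [add_mul]
    exact (normSup_sub_le (hA.mem f hf) (hB.mem f hf)).trans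
      (add_le_add (hA.le f hf r hr) (hB.le f hf r hr))
  dual ψ hψ := by
    obtain ⟨g, hg, hgd, hgl⟩ := hA.dual ψ hψ
    obtain ⟨h, hh, hhd, hhl⟩ := hB.dual ψ hψ
    refine ⟨g - h, hg.sub hh, hgd.sub hψ.integrable hg.integrable hh.integrable hhd,
      fun r hr => ?_⟩
    rw [add_mul]
    exact (normL1_sub_le hg hh).trans (add_le_add (hgl r hr) (hhl r hr))

/-- Losses add up. On functions `B` acts first, on densities `A^*` does, so the budget `R` is spent
in opposite orders in the two halves. -/
theorem HasOrder.mul {d R a b : ℕ} {A B : Op d} {M M' : ℝ} (hA : HasOrder R A a M)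
    (hB : HasOrder R B b M') (hM : 0 ≤ M) (hM₂ : 0 ≤ M') :
    HasOrder R (A * B) (a + b) (M * M') where
  mem f hf := hA.mem _ (hB.mem f hf)
  le f hf r hr := by
    have h1 := hA.le _ (hB.mem f hf) r (by omega)
    have h2 := hB.le f hf (a + r) (by omega)
    rw [show a + b + r = b + (a + r) by omega, mul_assoc]
    exact h1.trans (mul_le_mul_of_nonneg_left h2 hM)
  dual ψ hψ := by
    obtain ⟨g, hg, hgd, hgl⟩ := hA.dual ψ hψ
    obtain ⟨h, hh, hhd, hhl⟩ := hB.dual g hg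
    refine ⟨h, hh, fun f => (hgd (B f)).trans (hhd f), fun r hr => ?_⟩
    have h1 := hhl r (by omega)
    have h2 := hgl (b + r) (by omega)
    rw [show a + b + r = a + (b + r) by omega, mul_comm M, mul_assoc]
    exact h1.trans (mul_le_mul_of_nonneg_left h2 hM₂)

/-! ### Regularization -/

/-- `A` maps `C_b^∞`, with the uniform norm, to `C_b^a`, with constant `M`. -/
def GainsOrder {d : ℕ} (A : Op d) (a : ℕ) (M : ℝ) : Prop :=
  ∀ f : Mb d, IsSmoothCb (f : E d → ℝ) → IsSmoothCb (A f : E d → ℝ) ∧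
    normSup a (A f : E d → ℝ) ≤ M * supNorm (f : E d → ℝ)

theorem GainsOrder.mono {d a : ℕ} {A : Op d} {M M' : ℝ} (h : GainsOrder A a M) (hM : M ≤ M') :
    GainsOrder A a M' := fun f hf =>
  ⟨(h f hf).1, (h f hf).2.trans (mul_le_mul_of_nonneg_right hM (supNorm_nonneg _))⟩

theorem GainsOrder.add {d a : ℕ} {A B : Op d} {M M' : ℝ} (hA : GainsOrder A a M)
    (hB : GainsOrder B a M') : GainsOrder (A + B) a (M + M') := fun f hf => by
  refine ⟨(hA f hf).1.add (hB f hf).1, ?_⟩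
  rw [add_mul]
  exact (normSup_add_le (hA f hf).1 (hB f hf).1).trans (add_le_add (hA f hf).2 (hB f hf).2)

theorem GainsOrder.zero {d : ℕ} (a : ℕ) {M : ℝ} (hM : 0 ≤ M) : GainsOrder (0 : Op d) a M :=
  fun f hf => by
  have : ((0 : Op d) f : E d → ℝ) = 0 := rfl
  rw [this, normSup_zero_fun]
  exact ⟨isTest_zero.isSmoothCb, mul_nonneg hM (supNorm_nonneg _)⟩

theorem HasOrder.mul_gainsOrder {d R a b : ℕ} {A B : Op d} {M M' : ℝ} (hA : HasOrder R A b M)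
    (hB : GainsOrder B (b + a) M') (hM : 0 ≤ M) (hr : b + a ≤ R) :
    GainsOrder (A * B) a (M * M') := fun f hf => by
  refine ⟨hA.mem _ (hB f hf).1, ?_⟩
  rw [mul_assoc]
  exact (hA.le _ (hB f hf).1 a hr).trans (mul_le_mul_of_nonneg_left (hB f hf).2 hM)

/-- `A` compensates for the losses of derivatives of operators on both of its sides, as long as
the total loss does not exceed `R`. -/
def IsSmoothing {d : ℕ} (R : ℕ) (G : ℝ) (A : Op d) : Prop :=
  ∀ (a b : ℕ) (D : Op d) (M : ℝ), a + b ≤ R → 0 ≤ M → HasOrder R D b M →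
    GainsOrder (A * D) a (G * M)

/-- The dual form of regularization, where `ψ = ±A^* ∂^ρ φ`. For a test function `u`, `∫ u ∂^γ ψ =
±∫ A(∂^γ u) ∂^ρ φ = ±∫ ∂^ρ(A ∂^γ u) φ`, and `∂^ρ A ∂^γ` is bounded by `G` in the uniform norm; `L¹`
duality concludes. -/
theorem integral_abs_multiD_le_of_regularizes {d R : ℕ} {A : Op d} {G : ℝ} (hG : 0 ≤ G)
    (hmem : ∀ f : Mb d, IsSmoothCb (f : E d → ℝ) → IsSmoothCb (A f : E d → ℝ))
    (hreg : ∀ (r : ℕ) (γ : Fin d → ℕ), (∑ i, γ i) + r ≤ R → ∀ f g : Mb d,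
      IsSmoothCb (f : E d → ℝ) → (g : E d → ℝ) = multiD γ (f : E d → ℝ) →
      normSup r (A g : E d → ℝ) ≤ G * supNorm (f : E d → ℝ))
    {γ ρ : Fin d → ℕ} (hγρ : (∑ i, γ i) + ∑ i, ρ i ≤ R) {φ ψ : E d → ℝ} (hφ : IsTest φ)
    (hψ : IsSmoothC1 ψ) {w : List (Fin d)} (hw : multiD ρ = iterPartial w)
    (hdual : IsDualImage A (iterPartial w.reverse φ) ψ) :
    ∫ x, |multiD γ ψ x| ≤ G * ∫ x, |φ x| := by
  have hφ0 : 0 ≤ ∫ x, |φ x| := integral_nonneg fun _ => abs_nonneg _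
  refine integral_abs_le_of_test ((isSmoothC1_iff.1 hψ).2 γ) (mul_nonneg hG hφ0)
    fun u hu C hC => ?_
  have e1 : |∫ x, u x * multiD γ ψ x| = |∫ x, multiD γ u x * ψ x| := by
    have h1 : ∀ x, u x * multiD γ ψ x = multiD γ ψ x * u x := fun x => mul_comm _ _
    have h2 : ∀ x, multiD γ u x * ψ x = ψ x * multiD γ u x := fun x => mul_comm _ _
    simp only [h1, h2]
    unfold multiD
    rw [abs_integral_iterPartial_mul hψ.contDiff hu,
      iterPartial_perm hu.contDiff (List.reverse_perm _)]
  have hg := (hu.multiD γ)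
  have hAg : IsSmoothCb (A hg.toMb : E d → ℝ) := hmem _ hg.isSmoothCb
  have e2 : ∫ x, multiD γ u x * ψ x
      = ∫ x, (A hg.toMb : E d → ℝ) x * iterPartial w.reverse φ x := (hdual hg.toMb).symm
  rw [e1, e2, ← abs_integral_iterPartial_mul hAg.contDiff hφ, ← hw]
  have hle := hreg (∑ i, ρ i) γ hγρ hu.toMb hg.toMb hu.isSmoothCb rfl
  have hsup : supNorm u ≤ C := supNorm_le hC
  obtain ⟨B, hB⟩ := (isSmoothCb_iff.1 hAg).2 ρ
  have hpt : ∀ x, |multiD ρ (A hg.toMb : E d → ℝ) x| ≤ G * C := fun x =>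
    (abs_le_supNorm hB x).trans ((supNorm_multiD_le_normSup (mem_multiIdx.2 le_rfl) _).trans
      (hle.trans (mul_le_mul_of_nonneg_left hsup hG)))
  refine abs_integral_le_integral_abs.trans ?_
  calc ∫ x, |multiD ρ (A hg.toMb : E d → ℝ) x * φ x| ≤ ∫ x, G * C * |φ x| := by
        refine integral_mono (integrable_mul_test (contDiff_multiD hAg.contDiff ρ).continuous
          hφ).abs ((hφ.integrable volume).abs.const_mul _) fun x => ?_
        simp only [abs_mul]
        exact mul_le_mul_of_nonneg_right (hpt x) (abs_nonneg _)
    _ = G * (∫ x, |φ x|) * C := by rw [integral_const_mul]; ring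

/-- The regularization property, combined with the existence of duals, makes `A` smoothing. -/
theorem isSmoothing_of_regularizes {d R : ℕ} {A : Op d} {G K : ℝ} (hG : 0 ≤ G)
    (hA : HasOrder R A 0 K)
    (hreg : ∀ (r : ℕ) (γ : Fin d → ℕ), (∑ i, γ i) + r ≤ R → ∀ f g : Mb d,
      IsSmoothCb (f : E d → ℝ) → (g : E d → ℝ) = multiD γ (f : E d → ℝ) →
      normSup r (A g : E d → ℝ) ≤ G * supNorm (f : E d → ℝ)) :
    IsSmoothing R (((multiIdx d R).card : ℝ) ^ 2 * G) A := by
  intro a b D M hab hM hD f hf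
  have hADf : IsSmoothCb (A (D f) : E d → ℝ) := hA.mem _ (hD.mem f hf)
  refine ⟨hADf, ?_⟩
  set N : ℝ := ((multiIdx d R).card : ℝ) with hN
  have hcard : ∀ r, r ≤ R → ((multiIdx d r).card : ℝ) ≤ N := fun r hr =>
    Nat.cast_le.2 (Finset.card_le_card (multiIdx_mono hr))
  have hS := supNorm_nonneg (f : E d → ℝ)
  have key : ∀ ρ ∈ multiIdx d a, ∀ x, |multiD ρ (A (D f) : E d → ℝ) x|
      ≤ supNorm (f : E d → ℝ) * (M * (N * G)) := by
    intro ρ hρ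
    refine abs_le_of_test (contDiff_multiD hADf.contDiff ρ).continuous fun φ hφ => ?_
    have hφ0 : 0 ≤ ∫ x, |φ x| := integral_nonneg fun _ => abs_nonneg _
    obtain ⟨w, hw⟩ : ∃ w, (multiD ρ : (E d → ℝ) → E d → ℝ) = iterPartial w := ⟨_, rfl⟩
    -- Both operators are moved to the other side of the pairing: `f` then meets `h = D^* A^* ∂^ρ φ`
    -- and need not be differentiated.
    obtain ⟨ψ, hψ, hψd, -⟩ := hA.dual _ (hφ.iterPartial w.reverse).isSmoothC1
    obtain ⟨h, hh, hhd, hhl⟩ := hD.dual ψ hψ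
    rw [hw, abs_integral_iterPartial_mul hADf.contDiff hφ, hψd (D f), hhd f]
    -- One factor `N` counts the multi-indices of this norm; the other one in the final constant
    -- counts those of `normSup a`.
    have h1 : normL1 b ψ ≤ N * (G * ∫ x, |φ x|) := by
      calc normL1 b ψ ≤ ∑ γ ∈ multiIdx d b, G * ∫ x, |φ x| := by
            refine Finset.sum_le_sum fun γ hγ => ?_
            refine integral_abs_multiD_le_of_regularizes hG hA.mem hreg ?_ hφ hψ hw hψd
            rw [mem_multiIdx] at hγ hρ
            omega
        _ ≤ N * (G * ∫ x, |φ x|) := by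
            rw [Finset.sum_const, nsmul_eq_mul]
            exact mul_le_mul_of_nonneg_right (hcard b (by omega)) (mul_nonneg hG hφ0)
    have h2 : ∫ x, |h x| ≤ M * (N * (G * ∫ x, |φ x|)) :=
      (integral_abs_le_normL1 0 h).trans ((hhl 0 (by omega)).trans
        (mul_le_mul_of_nonneg_left h1 hM))
    refine abs_integral_le_integral_abs.trans ?_
    calc ∫ x, |(f : E d → ℝ) x * h x| ≤ ∫ x, supNorm (f : E d → ℝ) * |h x| := by
          refine integral_mono (integrable_Mb_mul f hh.integrable).abs
            (hh.integrable.abs.const_mul _) fun x => ?_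
          simp only [abs_mul]
          exact mul_le_mul_of_nonneg_right (Mb.abs_le_supNorm f x) (abs_nonneg _)
      _ = supNorm (f : E d → ℝ) * ∫ x, |h x| := integral_const_mul _ _
      _ ≤ supNorm (f : E d → ℝ) * (M * (N * (G * ∫ x, |φ x|))) :=
          mul_le_mul_of_nonneg_left h2 hS
      _ = supNorm (f : E d → ℝ) * (M * (N * G)) * ∫ x, |φ x| := by ring
  have hN0 : 0 ≤ N := Nat.cast_nonneg _
  have hX : 0 ≤ supNorm (f : E d → ℝ) * (M * (N * G)) := by positivity
  calc normSup a (A (D f) : E d → ℝ)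
      ≤ ∑ ρ ∈ multiIdx d a, supNorm (f : E d → ℝ) * (M * (N * G)) :=
        Finset.sum_le_sum fun ρ hρ => supNorm_le (key ρ hρ)
    _ ≤ N * (supNorm (f : E d → ℝ) * (M * (N * G))) := by
        rw [Finset.sum_const, nsmul_eq_mul]
        exact mul_le_mul_of_nonneg_right (hcard a (by omega)) hX
    _ = N ^ 2 * G * M * supNorm (f : E d → ℝ) := by ring

/-! ### Chains of operators -/

theorem telescope_mul {A : Type*} [Ring A] (q l l' c c' : A) :
    q * l * c - q * l' * c' = q * (l - l') * c + q * l' * (c - c') := by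
  noncomm_ring

/-- Here `q` stays factored out on the left, for the case where `q` is the smoothing propagator. -/
theorem telescope_mul_left {A : Type*} [Ring A] (q l l' c c' : A) :
    q * l * c - q * l' * c' = q * ((l - l') * c + l' * (c - c')) := by
  noncomm_ring

/-- `(∏_j Q_{t_{j-1}, t_j - 1} Λ_{t_j}) F_{t_i}`: a chain with an arbitrary last factor. -/
def chainEnd {d : ℕ} (Q : ℕ → ℕ → Op d) (Λ : ℕ → Op d) (F : ℕ → Op d) : ℕ → List ℕ → Op d
  | s, [] => F s
  | s, t :: ts => Q s (t - 1) * Λ t * chainEnd Q Λ F t ts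

theorem chain_eq_chainEnd {d : ℕ} (Q : ℕ → ℕ → Op d) (Λ : ℕ → Op d) (e s : ℕ) (ts : List ℕ) :
    chain Q Λ e s ts = chainEnd Q Λ (fun j => Q j e) s ts := by
  induction ts generalizing s with
  | nil => rfl
  | cons t ts ih => simp only [chain, chainEnd, ih]

/-- The sum of the chains over all `s < t_1 < ⋯ < t_i ≤ e`. -/
def chainSum {d : ℕ} (Q : ℕ → ℕ → Op d) (Λ : ℕ → Op d) (F : ℕ → Op d) (e i s : ℕ) : Op d :=
  ∑ t ∈ Finset.powersetCard i (Finset.Ioc s e), chainEnd Q Λ F s (t.sort (· ≤ ·))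

theorem chainSum_zero {d : ℕ} (Q : ℕ → ℕ → Op d) (Λ F : ℕ → Op d) (e s : ℕ) :
    chainSum Q Λ F e 0 s = F s := by
  simp [chainSum, chainEnd]

theorem chainSum_self {d : ℕ} (Q : ℕ → ℕ → Op d) (Λ F : ℕ → Op d) (e i : ℕ) :
    chainSum Q Λ F e (i + 1) e = 0 := by
  rw [chainSum, Finset.Ioc_self, Finset.powersetCard_eq_empty.2 (by simp), Finset.sum_empty]

/-- The semigroup property on the grid `{0, …, N}`. -/
structure IsGridSemigroup {d : ℕ} (N : ℕ) (Q : ℕ → ℕ → Op d) : Prop where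
  refl : ∀ t ≤ N, Q t t = 1
  comp : ∀ s u t, s ≤ u → u ≤ t → t ≤ N → Q s u * Q u t = Q s t

/-- Either the first time is later than `s + 1`, and `Q s (s + 1)` factors out of the first
propagator, or it equals `s + 1`, and the first propagator is `Q s s = 1`. -/
theorem chainSum_succ {d N : ℕ} {Q : ℕ → ℕ → Op d} (hQ : IsGridSemigroup N Q) (Λ F : ℕ → Op d)
    {e s : ℕ} (i : ℕ) (hs : s < e) (he : e ≤ N) :
    chainSum Q Λ F e (i + 1) s = Q s (s + 1) * chainSum Q Λ F e (i + 1) (s + 1)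
      + Λ (s + 1) * chainSum Q Λ F e i (s + 1) := by
  have hins : Finset.Ioc s e = insert (s + 1) (Finset.Ioc (s + 1) e) := by
    ext x; simp only [Finset.mem_Ioc, Finset.mem_insert]; omega
  have hnot : s + 1 ∉ Finset.Ioc (s + 1) e := by simp
  have hsub : ∀ j, ∀ t ∈ Finset.powersetCard j (Finset.Ioc (s + 1) e), s + 1 ∉ t := by
    intro j t ht h
    exact hnot ((Finset.mem_powersetCard.1 ht).1 h)
  unfold chainSum
  rw [hins, Finset.powersetCard_succ_insert hnot, Finset.sum_union, Finset.sum_image]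
  · congr 1
    · rw [Finset.mul_sum]
      refine Finset.sum_congr rfl fun t ht => ?_
      rw [Finset.mem_powersetCard] at ht
      have hlen : (t.sort (· ≤ ·)).length = i + 1 := by rw [Finset.length_sort, ht.2]
      have hmem : ∀ u ∈ t.sort (· ≤ ·), s + 1 < u ∧ u ≤ e := fun u hu =>
        Finset.mem_Ioc.1 (ht.1 ((Finset.mem_sort _).1 hu))
      generalize t.sort (· ≤ ·) = l at hlen hmem
      cases l with
      | nil => simp at hlen
      | cons u l =>
        have := hmem u (by simp)
        simp only [chainEnd]
        rw [← hQ.comp s (s + 1) (u - 1) (by omega) (by omega) (by omega)]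
        simp only [mul_assoc]
    · rw [Finset.mul_sum]
      refine Finset.sum_congr rfl fun t ht => ?_
      have hmem := (Finset.mem_powersetCard.1 ht).1
      rw [Finset.sort_insert]
      · simp only [chainEnd, Nat.add_sub_cancel]
        rw [hQ.refl s (by omega), one_mul]
      · intro b hb
        exact (Finset.mem_Ioc.1 (hmem hb)).1.le
      · exact hsub _ t ht
  · intro t ht t' ht' h
    have h1 := hsub _ t ht
    have h2 := hsub _ t' ht'
    rw [← Finset.erase_insert h1, ← Finset.erase_insert h2]
    exact congrArg (fun u => Finset.erase u (s + 1)) h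
  · rw [Finset.disjoint_left]
    intro t ht ht'
    obtain ⟨u, _, rfl⟩ := Finset.mem_image.1 ht'
    exact hsub _ _ ht (Finset.mem_insert_self _ _)

/-- The one-step error of `Q`. -/
def stepErr {d : ℕ} (P Q : ℕ → ℕ → Op d) (t : ℕ) : Op d := P (t - 1) t - Q (t - 1) t

/-- Expansion of `P` in terms of `Q` and of the one-step errors. -/
theorem expansion {d N : ℕ} {P Q : ℕ → ℕ → Op d} (hP : IsGridSemigroup N P)
    (hQ : IsGridSemigroup N Q) {e : ℕ} (he : e ≤ N) (m : ℕ) {s : ℕ} (hs : s ≤ e) :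
    P s e = ∑ i ∈ Finset.range m,
        chainSum Q (stepErr P Q) (fun j => Q j e) e i s
      + chainSum Q (stepErr P Q) (fun j => P j e) e m s := by
  obtain ⟨k, rfl⟩ := Nat.exists_eq_add_of_le hs
  clear hs
  set D : ℕ → Op d := stepErr P Q with hD
  suffices H : ∀ k s m, s + k ≤ N → P s (s + k) = ∑ i ∈ Finset.range m,
        chainSum Q D (fun j => Q j (s + k)) (s + k) i s
      + chainSum Q D (fun j => P j (s + k)) (s + k) m s from H k s m he
  clear he m s k
  intro k
  induction k with
  | zero =>
    intro s m hs
    cases m with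
    | zero => simp [chainSum_zero]
    | succ m =>
      rw [Finset.sum_range_succ']
      simp only [Nat.add_zero, chainSum_self, chainSum_zero]
      rw [hP.refl s (by omega), hQ.refl s (by omega)]
      simp
  | succ k ih =>
    intro s m hs
    cases m with
    | zero => simp [chainSum_zero]
    | succ m =>
      have hsk : s + 1 + k = s + (k + 1) := by omega
      -- After one step, the term beginning with `Q` is expanded to the same order, while the term
      -- beginning with an error has used up one increment and is expanded to order one less.
      have h1 := ih (s + 1) (m + 1) (by omega)
      have h2 := ih (s + 1) m (by omega)
      rw [hsk] at h1 h2
      have hstep : P s (s + (k + 1)) = Q s (s + 1) * P (s + 1) (s + (k + 1))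
          + D (s + 1) * P (s + 1) (s + (k + 1)) := by
        rw [← hP.comp s (s + 1) (s + (k + 1)) (by omega) (by omega) (by omega), ← add_mul]
        congr 1
        exact (add_sub_cancel (Q s (s + 1)) (P s (s + 1))).symm
      rw [Finset.sum_range_succ', chainSum_succ hQ _ _ _ (by omega) (by omega)]
      simp only [chainSum_succ hQ _ _ _ (show s < s + (k + 1) by omega)
        (show s + (k + 1) ≤ N by omega)]
      rw [hstep]
      nth_rw 1 [h1]
      rw [h2, Finset.sum_range_succ', Finset.sum_add_distrib]
      simp only [chainSum_zero, mul_add, Finset.mul_sum]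
      rw [hQ.comp s (s + 1) _ (by omega) (by omega) (by omega)]
      abel

/-! ### Admissible times -/

/-- `s < t_1 < ⋯ < t_i ≤ e`. -/
def Admissible (e s : ℕ) (ts : List ℕ) : Prop :=
  (s :: ts).Pairwise (· < ·) ∧ ∀ t ∈ s :: ts, t ≤ e

theorem Admissible.start_le {e s : ℕ} {ts : List ℕ} (h : Admissible e s ts) : s ≤ e :=
  h.2 s (by simp)

theorem Admissible.cons {e s t : ℕ} {ts : List ℕ} (h : Admissible e s (t :: ts)) :
    s < t ∧ t ≤ e ∧ Admissible e t ts := by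
  obtain ⟨h1, h2⟩ := h
  rw [List.pairwise_cons] at h1
  exact ⟨h1.1 t (by simp), h2 t (by simp), h1.2, fun u hu => h2 u (List.mem_cons_of_mem _ hu)⟩

theorem admissible_sort {e s : ℕ} (hs : s ≤ e) {t : Finset ℕ} (ht : t ⊆ Finset.Ioc s e) :
    Admissible e s (t.sort (· ≤ ·)) := by
  have hmem : ∀ u ∈ t.sort (· ≤ ·), s < u ∧ u ≤ e := fun u hu =>
    Finset.mem_Ioc.1 (ht ((Finset.mem_sort _).1 hu))
  refine ⟨List.pairwise_cons.2 ⟨fun u hu => (hmem u hu).1, t.sortedLT_sort.pairwise⟩, ?_⟩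
  intro u hu
  rcases List.mem_cons.1 hu with rfl | hu
  · exact hs
  · exact (hmem u hu).2

/-- One of the gaps between consecutive times has length at least `g`. -/
def HasGap (g : ℝ) (e : ℕ) : ℕ → List ℕ → Prop
  | s, [] => g ≤ (e : ℝ) - s
  | s, t :: ts => g ≤ ((t - 1 : ℕ) : ℝ) - s ∨ HasGap g e t ts

/-- Pigeonhole: each increment occupies one grid step, so the `ts.length + 1` gaps have total length
`e - s - ts.length`. -/
theorem hasGap_of_le {g : ℝ} {e s : ℕ} {ts : List ℕ} (h : Admissible e s ts)
    (hg : ((ts.length : ℝ) + 1) * g + ts.length ≤ (e : ℝ) - s) : HasGap g e s ts := by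
  induction ts generalizing s with
  | nil => simpa [HasGap] using hg
  | cons t ts ih =>
    obtain ⟨h1, h2, h3⟩ := h.cons
    by_cases hgap : g ≤ ((t - 1 : ℕ) : ℝ) - s
    · exact Or.inl hgap
    · refine Or.inr (ih h3 ?_)
      rw [Nat.cast_sub (by omega)] at hgap
      push_cast [List.length_cons] at hg hgap
      linarith

/-! ### Estimates of chains -/

/-- The factors of a chain: the propagators lose no derivative, the increments lose `b`
derivatives and have size `ε`. -/
structure ChainBound {d : ℕ} (R e b : ℕ) (K ε : ℝ) (Q : ℕ → ℕ → Op d) (Λ F : ℕ → Op d) :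
    Prop where
  one_le : 1 ≤ K
  nonneg : 0 ≤ ε
  prop : ∀ j k, j ≤ k → k ≤ e → HasOrder R (Q j k) 0 K
  last : ∀ j ≤ e, HasOrder R (F j) 0 K
  incr : ∀ t, 1 ≤ t → t ≤ e → HasOrder R (Λ t) b ε

theorem ChainBound.hasOrder {d R e b : ℕ} {K ε : ℝ} {Q : ℕ → ℕ → Op d} {Λ F : ℕ → Op d}
    (h : ChainBound R e b K ε Q Λ F) {s : ℕ} {ts : List ℕ} (hts : Admissible e s ts) :
    HasOrder R (chainEnd Q Λ F s ts) (ts.length * b) (K * (K * ε) ^ ts.length) := by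
  have hK := h.one_le
  have hε := h.nonneg
  induction ts generalizing s with
  | nil => simpa [chainEnd] using h.last s hts.start_le
  | cons t ts ih =>
    obtain ⟨h1, h2, h3⟩ := hts.cons
    have := ((h.prop s (t - 1) (by omega) (by omega)).mul (h.incr t (by omega) h2)
      (by positivity) hε).mul (ih h3) (by positivity) (by positivity)
    simp only [chainEnd, List.length_cons]
    convert this using 1 <;> ring

/-- Increments are exchanged one at a time: each of the `ts.length` exchanges leaves one factor of
size `ε'`, the others keeping size `ε`. For the empty chain the factor `ts.length` is zero, so the
truncated exponent is harmless. -/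
theorem ChainBound.hasOrder_sub {d R e b : ℕ} {K ε ε' : ℝ} {Q : ℕ → ℕ → Op d} {Λ Λ' F : ℕ → Op d}
    (h : ChainBound R e b K ε Q Λ F) (h' : ChainBound R e b K ε Q Λ' F) (hε' : 0 ≤ ε')
    (hd : ∀ t, 1 ≤ t → t ≤ e → HasOrder R (Λ t - Λ' t) b ε')
    {s : ℕ} {ts : List ℕ} (hts : Admissible e s ts) :
    HasOrder R (chainEnd Q Λ F s ts - chainEnd Q Λ' F s ts) (ts.length * b)
      (ts.length * (K * ε') * K * (K * ε) ^ (ts.length - 1)) := by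
  have hK := h.one_le
  have hε := h.nonneg
  induction ts generalizing s with
  | nil =>
    have : chainEnd Q Λ F s [] - chainEnd Q Λ' F s [] = 0 := sub_self (F s)
    rw [this]
    simpa using HasOrder.zero R 0 le_rfl
  | cons t ts ih =>
    obtain ⟨h1, h2, h3⟩ := hts.cons
    have hQ := h.prop s (t - 1) (by omega) (by omega)
    have t1 := (hQ.mul (hd t (by omega) h2) (by positivity) hε').mul (h.hasOrder h3)
      (by positivity) (by positivity)
    have t2 := (hQ.mul (h'.incr t (by omega) h2) (by positivity) hε).mul (ih h3)
      (by positivity) (by positivity)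
    have e : chainEnd Q Λ F s (t :: ts) - chainEnd Q Λ' F s (t :: ts)
        = Q s (t - 1) * (Λ t - Λ' t) * chainEnd Q Λ F t ts
          + Q s (t - 1) * Λ' t * (chainEnd Q Λ F t ts - chainEnd Q Λ' F t ts) :=
      telescope_mul (Q s (t - 1)) (Λ t) (Λ' t) _ _
    rw [e]
    convert t1.add t2 using 1
    · simp only [List.length_cons]; ring
    · cases ts with
      | nil => simp
      | cons u ts => simp only [List.length_cons, Nat.add_sub_cancel]; push_cast; ring

/-- The propagators over long gaps are smoothing. -/
structure GapSmoothing {d : ℕ} (R e : ℕ) (g G : ℝ) (Q : ℕ → ℕ → Op d) (F : ℕ → Op d) :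
    Prop where
  nonneg : 0 ≤ G
  prop : ∀ j k : ℕ, j ≤ k → k ≤ e → g ≤ (k : ℝ) - j → IsSmoothing R G (Q j k)
  last : ∀ j : ℕ, j ≤ e → g ≤ (e : ℝ) - j → IsSmoothing R G (F j)

/-- One long gap pays for all losses on both of its sides, within the budget `a + ts.length * b ≤
R`. -/
theorem ChainBound.gainsOrder {d R e b : ℕ} {K ε g G : ℝ} {Q : ℕ → ℕ → Op d} {Λ F : ℕ → Op d}
    (h : ChainBound R e b K ε Q Λ F) (hs : GapSmoothing R e g G Q F) {s : ℕ} {ts : List ℕ}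
    (hts : Admissible e s ts) (hgap : HasGap g e s ts) {a : ℕ} (ha : a + ts.length * b ≤ R) :
    GainsOrder (chainEnd Q Λ F s ts) a (G * (K * (K * ε) ^ ts.length)) := by
  have hK := h.one_le
  have hε := h.nonneg
  have hG := hs.nonneg
  induction ts generalizing s a with
  | nil =>
    have := hs.last s hts.start_le hgap a 0 1 1 (by simpa using ha) zero_le_one (HasOrder.one R)
    rw [mul_one] at this
    refine this.mono ?_
    simp only [List.length_nil, pow_zero, mul_one]
    nlinarith
  | cons t ts ih =>
    obtain ⟨h1, h2, h3⟩ := hts.cons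
    have hlen : (t :: ts).length * b = ts.length * b + b := by simp [add_mul]
    rcases hgap with hgap | hgap
    -- The gap comes first: all the rest of the chain is the lossy operator on its right.
    · have hD := (h.incr t (by omega) h2).mul (h.hasOrder h3) hε (by positivity)
      have := hs.prop s (t - 1) (by omega) (by omega) hgap a _ _ _ (by omega)
        (by positivity) hD
      rw [← mul_assoc] at this
      refine this.mono ?_
      refine mul_le_mul_of_nonneg_left ?_ hG
      simp only [List.length_cons, pow_succ]
      have : ε * (K * (K * ε) ^ ts.length) ≤ K * (ε * (K * (K * ε) ^ ts.length)) :=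
        le_mul_of_one_le_left (by positivity) hK
      refine this.trans (le_of_eq (by ring))
    -- The gap lies further right: the tail must gain `b` extra derivatives, which `Λ t` then
    -- spends.
    · have hL := (h.prop s (t - 1) (by omega) (by omega)).mul (h.incr t (by omega) h2)
        (by positivity) hε
      rw [zero_add] at hL
      have := hL.mul_gainsOrder (ih h3 hgap (a := b + a) (by omega)) (by positivity) (by omega)
      refine this.mono (le_of_eq ?_)
      simp only [List.length_cons]; ring

theorem ChainBound.gainsOrder_sub {d R e b : ℕ} {K ε ε' g G : ℝ} {Q : ℕ → ℕ → Op d}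
    {Λ Λ' F : ℕ → Op d} (h : ChainBound R e b K ε Q Λ F) (h' : ChainBound R e b K ε Q Λ' F)
    (hs : GapSmoothing R e g G Q F) (hε' : 0 ≤ ε')
    (hd : ∀ t, 1 ≤ t → t ≤ e → HasOrder R (Λ t - Λ' t) b ε')
    {s : ℕ} {ts : List ℕ} (hts : Admissible e s ts) (hgap : HasGap g e s ts) {a : ℕ}
    (ha : a + ts.length * b ≤ R) :
    GainsOrder (chainEnd Q Λ F s ts - chainEnd Q Λ' F s ts) a
      (G * (ts.length * (K * ε') * K * (K * ε) ^ (ts.length - 1))) := by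
  have hK := h.one_le
  have hε := h.nonneg
  have hG := hs.nonneg
  induction ts generalizing s a with
  | nil =>
    have : chainEnd Q Λ F s [] - chainEnd Q Λ' F s [] = 0 := sub_self (F s)
    rw [this]
    simpa using GainsOrder.zero a le_rfl
  | cons t ts ih =>
    obtain ⟨h1, h2, h3⟩ := hts.cons
    have hlen : (t :: ts).length * b = b + ts.length * b := by simp [add_mul, add_comm]
    have hQ := h.prop s (t - 1) (by omega) (by omega)
    rcases hgap with hgap | hgap
    -- The two telescoped terms together form the lossy operator to the right of the gap.
    · have hD := ((hd t (by omega) h2).mul (h.hasOrder h3) hε' (by positivity)).add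
        ((h'.incr t (by omega) h2).mul (h.hasOrder_sub h' hε' hd h3) hε (by positivity))
      have := hs.prop s (t - 1) (by omega) (by omega) hgap a _ _ _ (by omega)
        (by positivity) hD
      have e : chainEnd Q Λ F s (t :: ts) - chainEnd Q Λ' F s (t :: ts)
          = Q s (t - 1) * ((Λ t - Λ' t) * chainEnd Q Λ F t ts
            + Λ' t * (chainEnd Q Λ F t ts - chainEnd Q Λ' F t ts)) :=
        telescope_mul_left (Q s (t - 1)) (Λ t) (Λ' t) _ _
      rw [e]
      refine this.mono (mul_le_mul_of_nonneg_left ?_ hG)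
      refine (le_mul_of_one_le_left (by positivity) hK).trans (le_of_eq ?_)
      cases ts with
      | nil => simp; ring
      | cons u ts => simp only [List.length_cons, Nat.add_sub_cancel]; push_cast; ring
    -- The gap lies in the tail, so the two telescoped terms are treated separately: one contains a
    -- tail, the other a difference of tails.
    · have hL1 := hQ.mul (hd t (by omega) h2) (by positivity) hε'
      have hL2 := hQ.mul (h'.incr t (by omega) h2) (by positivity) hε
      rw [zero_add] at hL1 hL2
      have t1 := hL1.mul_gainsOrder (h.gainsOrder hs h3 hgap (a := b + a) (by omega))
        (by positivity) (by omega)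
      have t2 := hL2.mul_gainsOrder (ih h3 hgap (a := b + a) (by omega))
        (by positivity) (by omega)
      have e : chainEnd Q Λ F s (t :: ts) - chainEnd Q Λ' F s (t :: ts)
          = Q s (t - 1) * (Λ t - Λ' t) * chainEnd Q Λ F t ts
            + Q s (t - 1) * Λ' t * (chainEnd Q Λ F t ts - chainEnd Q Λ' F t ts) :=
        telescope_mul (Q s (t - 1)) (Λ t) (Λ' t) _ _
      rw [e]
      refine (t1.add t2).mono (le_of_eq ?_)
      cases ts with
      | nil => simp; ring
      | cons u ts => simp only [List.length_cons, Nat.add_sub_cancel]; push_cast; ring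

/-! ### The error of `Qhat` in terms of chains -/

/-- A grid semigroup `P l`, the same one for all grids, and its approximations `Q l`, with bounds
uniform in the range of orders of differentiation up to `R`. -/
structure GridSystem {d : ℕ} (α : ℝ) (β R L : ℕ) (K T : ℝ) (n : ℕ) (P Q : ℕ → ℕ → ℕ → Op d) :
    Prop where
  T_pos : 0 < T
  n_pos : 1 ≤ n
  one_le : 1 ≤ K
  semiP : ∀ l, IsGridSemigroup (n ^ l) (P l)
  refine_eq : ∀ l k, P l k (k + 1) = P (l + 1) (k * n) (k * n + n)
  semiQ : ∀ l, 1 ≤ l → l ≤ L → IsGridSemigroup (n ^ l) (Q l)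
  ordP : ∀ l j k, j ≤ k → k ≤ n ^ l → HasOrder R (P l j k) 0 K
  ordQ : ∀ l, 1 ≤ l → l ≤ L → ∀ j k, j ≤ k → k ≤ n ^ l → HasOrder R (Q l j k) 0 K
  err : ∀ l, 1 ≤ l → l ≤ L → ∀ k, k + 1 ≤ n ^ l →
    HasOrder R (P l k (k + 1) - Q l k (k + 1)) β (K * step T n l ^ (α + 1))

/-- A relation between operators and sizes which is compatible with sums. -/
structure IsSizeRel {d : ℕ} (S : Op d → ℝ → Prop) : Prop where
  zero : S 0 0
  add : ∀ A B x y, S A x → S B y → S (A + B) (x + y)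
  mono : ∀ A x y, S A x → x ≤ y → S A y

theorem IsSizeRel.sum {d : ℕ} {S : Op d → ℝ → Prop} (hS : IsSizeRel S) {ι : Type*} (s : Finset ι)
    {A : ι → Op d} {x : ι → ℝ} (h : ∀ i ∈ s, S (A i) (x i)) :
    S (∑ i ∈ s, A i) (∑ i ∈ s, x i) := by
  classical
  induction s using Finset.induction_on with
  | empty => simpa using hS.zero
  | insert i s his ih =>
    rw [Finset.sum_insert his, Finset.sum_insert his]
    exact hS.add _ _ _ _ (h i (by simp)) (ih fun j hj => h j (by simp [hj]))

theorem IsSizeRel.sum_powersetCard {d : ℕ} {S : Op d → ℝ → Prop} (hS : IsSizeRel S) (i s n : ℕ)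
    {A : Finset ℕ → Op d} {x : ℝ} (hx : 0 ≤ x)
    (h : ∀ t ∈ Finset.powersetCard i (Finset.Ioc s (s + n)), S (A t) x) :
    S (∑ t ∈ Finset.powersetCard i (Finset.Ioc s (s + n)), A t) ((n : ℝ) ^ i * x) := by
  refine hS.mono _ _ _ (hS.sum _ h) ?_
  rw [Finset.sum_const, nsmul_eq_mul, Finset.card_powersetCard, Nat.card_Ioc]
  refine mul_le_mul_of_nonneg_right ?_ hx
  have : (s + n - s).choose i ≤ n ^ i := by
    rw [Nat.add_sub_cancel_left]; exact Nat.choose_le_pow n i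
  exact_mod_cast this

/-- With this relation and the next one, a single count of chains serves both the fine grids, where
derivatives are lost, and the coarsest grid, where regularization recovers them. -/
theorem isSizeRel_hasOrder {d : ℕ} (R a : ℕ) :
    IsSizeRel fun (A : Op d) x => 0 ≤ x ∧ HasOrder R A a x where
  zero := ⟨le_rfl, HasOrder.zero R a le_rfl⟩
  add _ _ _ _ h h' := ⟨add_nonneg h.1 h'.1, h.2.add h'.2⟩
  mono _ _ _ h hxy := ⟨h.1.trans hxy, h.2.mono le_rfl hxy (h.1.trans hxy)⟩

theorem isSizeRel_gainsOrder {d : ℕ} (a : ℕ) :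
    IsSizeRel fun (A : Op d) x => GainsOrder A a x where
  zero := GainsOrder.zero a le_rfl
  add _ _ _ _ h h' := h.add h'
  mono _ _ _ h hxy := h.mono hxy

/-- The one-step correction of order `q` on the grid `l`. -/
def correction {d : ℕ} (α : ℝ) (hα : 0 < α) (n : ℕ) (Q : ℕ → ℕ → ℕ → Op d) (l : ℕ) (q : ℝ)
    (u : ℕ) : Op d := Qhat α hα n Q l q (u - 1) - Q l (u - 1) u

theorem Qhat_eq {d : ℕ} (α : ℝ) (hα : 0 < α) (n : ℕ) (Q : ℕ → ℕ → ℕ → Op d) (l : ℕ) (μ : ℝ)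
    (k : ℕ) : Qhat α hα n Q l μ k = Q (l + 1) (k * n) (k * n + n) +
      ∑ i : Fin (mOrd α l μ - 1),
        ∑ t ∈ Finset.powersetCard ((i : ℕ) + 1) (Finset.Ioc (k * n) (k * n + n)),
          chainEnd (Q (l + 1)) (correction α hα n Q (l + 1) (qOrd α (i + 1) l μ))
            (fun j => Q (l + 1) j (k * n + n)) (k * n) (t.sort (· ≤ ·)) := by
  rw [Qhat]
  simp only [chain_eq_chainEnd]
  rfl

theorem sub_add_sum_eq {A : Type*} [AddCommGroup A] {ι κ : Type*} [Fintype ι] (s : ι → Finset κ)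
    (f g : ι → κ → A) (p q r : A) (h : p = (∑ i, ∑ t ∈ s i, f i t) + q + r) :
    p - (q + ∑ i, ∑ t ∈ s i, g i t) = ∑ i, ∑ t ∈ s i, (f i t - g i t) + r := by
  simp only [h, Finset.sum_sub_distrib]
  abel

theorem Op.sub_add_sum_eq {d : ℕ} {ι κ : Type*} [Fintype ι] (s : ι → Finset κ)
    (f g : ι → κ → Op d) (p q r : Op d) (h : p = (∑ i, ∑ t ∈ s i, f i t) + q + r) :
    p - (q + ∑ i, ∑ t ∈ s i, g i t) = ∑ i, ∑ t ∈ s i, (f i t - g i t) + r :=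
  WeakApprox.sub_add_sum_eq s f g p q r h

/-- `Qhat` is the truncated expansion of `P` with step errors replaced by corrections, so only the
replacement error and the remainder survive; the chains without increments cancel. -/
theorem error_eq {d : ℕ} {α : ℝ} (hα : 0 < α) {β R L n : ℕ} {K T : ℝ}
    {P Q : ℕ → ℕ → ℕ → Op d} (hsys : GridSystem α β R L K T n P Q) {l : ℕ} (hl : l + 1 ≤ L)
    {μ : ℝ} (hm : 1 ≤ mOrd α l μ) {k : ℕ} (hk : k < n ^ l) :
    P l k (k + 1) - Qhat α hα n Q l μ k
      = ∑ i : Fin (mOrd α l μ - 1),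
          ∑ t ∈ Finset.powersetCard ((i : ℕ) + 1) (Finset.Ioc (k * n) (k * n + n)),
            (chainEnd (Q (l + 1)) (stepErr (P (l + 1)) (Q (l + 1)))
                (fun j => Q (l + 1) j (k * n + n)) (k * n) (t.sort (· ≤ ·))
              - chainEnd (Q (l + 1)) (correction α hα n Q (l + 1) (qOrd α (i + 1) l μ))
                (fun j => Q (l + 1) j (k * n + n)) (k * n) (t.sort (· ≤ ·)))
        + ∑ t ∈ Finset.powersetCard (mOrd α l μ) (Finset.Ioc (k * n) (k * n + n)),
            chainEnd (Q (l + 1)) (stepErr (P (l + 1)) (Q (l + 1)))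
              (fun j => P (l + 1) j (k * n + n)) (k * n) (t.sort (· ≤ ·)) := by
  have he : k * n + n ≤ n ^ (l + 1) := by
    rw [pow_succ, ← Nat.succ_mul]; exact Nat.mul_le_mul_right n hk
  have hexp := expansion (hsys.semiP (l + 1)) (hsys.semiQ (l + 1) (by omega) hl) he
    (mOrd α l μ - 1 + 1) (s := k * n) (by omega)
  rw [Finset.sum_range_succ', chainSum_zero, Finset.sum_range, Nat.sub_add_cancel hm] at hexp
  simp only [chainSum] at hexp
  rw [hsys.refine_eq, Qhat_eq]
  exact Op.sub_add_sum_eq (fun i : Fin (mOrd α l μ - 1) =>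
    Finset.powersetCard ((i : ℕ) + 1) (Finset.Ioc (k * n) (k * n + n))) _ _ _ _ _ hexp

/-- The error of `Qhat` is bounded by bounding all chains. -/
theorem error_size {d : ℕ} {α : ℝ} (hα : 0 < α) {β R L n : ℕ} {K T : ℝ}
    {P Q : ℕ → ℕ → ℕ → Op d} (hsys : GridSystem α β R L K T n P Q) {l : ℕ} (hl : l + 1 ≤ L)
    {μ : ℝ} (hm : 1 ≤ mOrd α l μ) {k : ℕ} (hk : k < n ^ l) {S : Op d → ℝ → Prop}
    (hS : IsSizeRel S) {X : Fin (mOrd α l μ - 1) → ℝ} {Y : ℝ} (hX : ∀ i, 0 ≤ X i) (hY : 0 ≤ Y)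
    (h1 : ∀ (i : Fin (mOrd α l μ - 1)) (ts : List ℕ), Admissible (k * n + n) (k * n) ts →
      ts.length = i + 1 →
      S (chainEnd (Q (l + 1)) (stepErr (P (l + 1)) (Q (l + 1)))
          (fun j => Q (l + 1) j (k * n + n)) (k * n) ts
        - chainEnd (Q (l + 1)) (correction α hα n Q (l + 1) (qOrd α (i + 1) l μ))
          (fun j => Q (l + 1) j (k * n + n)) (k * n) ts) (X i))
    (h2 : ∀ ts : List ℕ, Admissible (k * n + n) (k * n) ts → ts.length = mOrd α l μ →
      S (chainEnd (Q (l + 1)) (stepErr (P (l + 1)) (Q (l + 1)))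
          (fun j => P (l + 1) j (k * n + n)) (k * n) ts) Y) :
    S (P l k (k + 1) - Qhat α hα n Q l μ k)
      (∑ i : Fin (mOrd α l μ - 1), (n : ℝ) ^ ((i : ℕ) + 1) * X i + (n : ℝ) ^ mOrd α l μ * Y) := by
  rw [error_eq hα hsys hl hm hk]
  refine hS.add _ _ _ _ (hS.sum _ fun i _ => ?_) ?_
  · refine hS.sum_powersetCard _ _ _ (hX i) fun t ht => ?_
    rw [Finset.mem_powersetCard] at ht
    exact h1 i _ (admissible_sort (by omega) ht.1) (by rw [Finset.length_sort, ht.2])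
  · refine hS.sum_powersetCard _ _ _ hY fun t ht => ?_
    rw [Finset.mem_powersetCard] at ht
    exact h2 _ (admissible_sort (by omega) ht.1) (by rw [Finset.length_sort, ht.2])

/-! ### Counting powers of `n` -/

theorem rpow_step {T : ℝ} (hT : 0 < T) {n : ℕ} (hn : 1 ≤ n) (l : ℕ) (α : ℝ) :
    step T n l ^ (α + 1) = T ^ (α + 1) * (n : ℝ) ^ (-((l : ℝ) * (1 + α))) := by
  have hn0 : (0 : ℝ) ≤ n := Nat.cast_nonneg n
  rw [step, Real.div_rpow hT.le (by positivity), ← Real.rpow_natCast, ← Real.rpow_mul hn0,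
    Real.rpow_neg hn0, div_eq_mul_inv, add_comm 1 α]

/-- The sum of the sizes of all chains. -/
theorem sum_sizes_le {α : ℝ} (hα : 0 < α) (l : ℕ) {μ : ℝ} {n : ℕ} (hn : 1 ≤ n) {K V : ℝ}
    (hK : 1 ≤ K) (hV : 1 ≤ V) (hm : 1 ≤ mOrd α l μ) :
    ∑ i : Fin (mOrd α l μ - 1), (n : ℝ) ^ ((i : ℕ) + 1) *
        (((i : ℕ) + 1 : ℕ) * (V * (n : ℝ) ^ (-qOrd α (i + 1) l μ)) * K
          * (V * (n : ℝ) ^ (-(((l + 1 : ℕ) : ℝ) * (1 + α)))) ^ (i : ℕ))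
      + (n : ℝ) ^ mOrd α l μ *
        (K * (V * (n : ℝ) ^ (-(((l + 1 : ℕ) : ℝ) * (1 + α)))) ^ mOrd α l μ)
      ≤ K * V ^ mOrd α l μ * ((mOrd α l μ : ℝ) ^ 2 + 1) * (n : ℝ) ^ (-μ) := by
  set m := mOrd α l μ with hmdef
  have hn1 : (1 : ℝ) ≤ n := by exact_mod_cast hn
  have hn0 : (0 : ℝ) < n := by linarith
  have hnμ : 0 < (n : ℝ) ^ (-μ) := Real.rpow_pos_of_pos hn0 _
  have hbase : ∀ j : ℕ, (V * (n : ℝ) ^ (-(((l + 1 : ℕ) : ℝ) * (1 + α)))) ^ j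
      = V ^ j * (n : ℝ) ^ (-(((l + 1 : ℕ) : ℝ) * (1 + α)) * j) := fun j => by
    rw [mul_pow, Real.rpow_mul hn0.le, Real.rpow_natCast]
  have hterm : ∀ i : Fin (m - 1), (n : ℝ) ^ ((i : ℕ) + 1) *
        (((i : ℕ) + 1 : ℕ) * (V * (n : ℝ) ^ (-qOrd α (i + 1) l μ)) * K
          * (V * (n : ℝ) ^ (-(((l + 1 : ℕ) : ℝ) * (1 + α)))) ^ (i : ℕ))
      ≤ K * V ^ m * m * (n : ℝ) ^ (-μ) := fun i => by
    have hi : (i : ℕ) + 1 ≤ m := by have := i.2; omega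
    rw [hbase]
    -- The ceiling in `qOrd` makes this exponent at most `-μ`; the chain has `i + 1` increments, `i`
    -- of them of the size of a step error.
    have e : (n : ℝ) ^ ((i : ℕ) + 1) * (n : ℝ) ^ (-qOrd α (i + 1) l μ)
        * (n : ℝ) ^ (-(((l + 1 : ℕ) : ℝ) * (1 + α)) * (i : ℕ)) ≤ (n : ℝ) ^ (-μ) := by
      rw [← Real.rpow_natCast, ← Real.rpow_add hn0, ← Real.rpow_add hn0]
      refine Real.rpow_le_rpow_of_exponent_le hn1 ?_
      have := Int.le_ceil ((((i : ℕ) + 1 : ℕ) : ℝ)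
        - (1 + α) * (l + 1) * ((((i : ℕ) + 1 : ℕ) : ℝ) - 1))
      unfold qOrd
      push_cast at this ⊢
      linarith
    have hVi : V ^ ((i : ℕ) + 1) ≤ V ^ m := pow_le_pow_right₀ hV hi
    have hi' : (((i : ℕ) + 1 : ℕ) : ℝ) ≤ m := by exact_mod_cast hi
    calc _ = K * V ^ ((i : ℕ) + 1) * (((i : ℕ) + 1 : ℕ) : ℝ) *
          ((n : ℝ) ^ ((i : ℕ) + 1) * (n : ℝ) ^ (-qOrd α (i + 1) l μ)
            * (n : ℝ) ^ (-(((l + 1 : ℕ) : ℝ) * (1 + α)) * (i : ℕ))) := by ring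
      _ ≤ K * V ^ m * m * (n : ℝ) ^ (-μ) := by gcongr
  have hlast : (n : ℝ) ^ m *
        (K * (V * (n : ℝ) ^ (-(((l + 1 : ℕ) : ℝ) * (1 + α)))) ^ m)
      ≤ K * V ^ m * (n : ℝ) ^ (-μ) := by
    rw [hbase]
    -- The exponent is `-m((1+α)l+α)`, at most `-μ` by the ceiling in `mOrd`.
    have e : (n : ℝ) ^ m * (n : ℝ) ^ (-(((l + 1 : ℕ) : ℝ) * (1 + α)) * (m : ℕ))
        ≤ (n : ℝ) ^ (-μ) := by
      rw [← Real.rpow_natCast, ← Real.rpow_add hn0]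
      refine Real.rpow_le_rpow_of_exponent_le hn1 ?_
      have h1 : μ / ((1 + α) * l + α) ≤ m := Nat.le_ceil _
      rw [div_le_iff₀ (by positivity)] at h1
      push_cast
      linarith
    calc _ = K * V ^ m * ((n : ℝ) ^ m
            * (n : ℝ) ^ (-(((l + 1 : ℕ) : ℝ) * (1 + α)) * (m : ℕ))) := by ring
      _ ≤ K * V ^ m * (n : ℝ) ^ (-μ) := by gcongr
  have hsum := Finset.sum_le_card_nsmul Finset.univ _ _ fun i (_ : i ∈ Finset.univ) => hterm i
  rw [Finset.card_univ, Fintype.card_fin, nsmul_eq_mul] at hsum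
  have hm1 : ((m - 1 : ℕ) : ℝ) ≤ m := by exact_mod_cast Nat.sub_le m 1
  have : ((m - 1 : ℕ) : ℝ) * (K * V ^ m * m * (n : ℝ) ^ (-μ))
      ≤ m * (K * V ^ m * m * (n : ℝ) ^ (-μ)) :=
    mul_le_mul_of_nonneg_right hm1 (by positivity)
  calc _ ≤ m * (K * V ^ m * m * (n : ℝ) ^ (-μ)) + K * V ^ m * (n : ℝ) ^ (-μ) :=
        add_le_add (hsum.trans this) hlast
    _ = K * V ^ m * ((m : ℝ) ^ 2 + 1) * (n : ℝ) ^ (-μ) := by ring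

/-! ### Errors on the finer grids, without regularization -/

/-- Bounds for the error of `Qhat` on the grid `l`. -/
structure ErrorBound {d : ℕ} (α : ℝ) (hα : 0 < α) (β R l : ℕ) (μ T : ℝ) (n : ℕ) (C p : ℝ)
    (P Q : ℕ → ℕ → ℕ → Op d) : Prop where
  high : ∀ k < n ^ l, HasOrder R (P l k (k + 1) - Qhat α hα n Q l μ k) (kappa α hα β l μ)
    (C * (n : ℝ) ^ (-μ) * (1 + T) ^ p)
  low : ∀ k < n ^ l, HasOrder R (P l k (k + 1) - Qhat α hα n Q l μ k)
    (max β (kappa α hα β l μ)) (C * (n : ℝ) ^ (-((l : ℝ) * (1 + α))) * (1 + T) ^ p)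

theorem ErrorBound.mono {d : ℕ} {α : ℝ} {hα : 0 < α} {β R l : ℕ} {μ T : ℝ} {n : ℕ}
    {C C' p p' : ℝ} {P Q : ℕ → ℕ → ℕ → Op d} (h : ErrorBound α hα β R l μ T n C p P Q)
    (hT : 0 ≤ T) (hC : C ≤ C') (hC' : 0 ≤ C') (hp : p ≤ p') :
    ErrorBound α hα β R l μ T n C' p' P Q := by
  have hpow : (1 + T) ^ p ≤ (1 + T) ^ p' :=
    Real.rpow_le_rpow_of_exponent_le (by linarith) hp
  have h1 : ∀ y : ℝ, C * (n : ℝ) ^ y * (1 + T) ^ p ≤ C' * (n : ℝ) ^ y * (1 + T) ^ p' := fun y => by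
    gcongr
  exact ⟨fun k hk => (h.high k hk).mono le_rfl (h1 _) (by positivity),
    fun k hk => (h.low k hk).mono le_rfl (h1 _) (by positivity)⟩

theorem Op.sub_eq_sub_sub {d : ℕ} (p a b : Op d) : a - b = (p - b) - (p - a) :=
  (sub_sub_sub_cancel_left b a p).symm

theorem Op.sub_sub_cancel_right {d : ℕ} (p a b : Op d) : (p - b) - (a - b) = p - a :=
  sub_sub_sub_cancel_right p a b

theorem GridSystem.stepErr_hasOrder {d : ℕ} {α : ℝ} (hα : 0 < α) {β R L n : ℕ} {K T : ℝ}
    {P Q : ℕ → ℕ → ℕ → Op d} (hsys : GridSystem α β R L K T n P Q) {l : ℕ} (hl1 : 1 ≤ l)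
    (hl : l ≤ L) {C p : ℝ} (hC : K ≤ C) (hp : α + 1 ≤ p) {t : ℕ} (ht : 1 ≤ t) (ht' : t ≤ n ^ l) :
    HasOrder R (stepErr (P l) (Q l) t) β
      (C * (n : ℝ) ^ (-((l : ℝ) * (1 + α))) * (1 + T) ^ p) := by
  obtain ⟨u, rfl⟩ := Nat.exists_eq_add_of_le' ht
  have hT := hsys.T_pos
  have hK := hsys.one_le
  have hC0 : 0 ≤ C := by linarith
  have h := hsys.err l hl1 hl u ht'
  rw [rpow_step hT hsys.n_pos] at h
  refine h.mono le_rfl ?_ (by positivity)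
  have h1 : T ^ (α + 1) ≤ (1 + T) ^ p :=
    (Real.rpow_le_rpow hT.le (by linarith) (by linarith)).trans
      (Real.rpow_le_rpow_of_exponent_le (by linarith) hp)
  calc K * (T ^ (α + 1) * (n : ℝ) ^ (-((l : ℝ) * (1 + α))))
      ≤ C * ((1 + T) ^ p * (n : ℝ) ^ (-((l : ℝ) * (1 + α)))) := by gcongr
    _ = _ := by ring

/-- A correction is a step error minus the error of `Qhat`. The order `q` may lie below `l(1+α)`, so
the bound `low`, not `high`, keeps corrections of the size of a step error; the factor 2 counts the
two terms. -/
theorem ErrorBound.correction_hasOrder {d : ℕ} {α : ℝ} {hα : 0 < α} {β R L n : ℕ} {K T : ℝ}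
    {P Q : ℕ → ℕ → ℕ → Op d} (hsys : GridSystem α β R L K T n P Q) {l : ℕ} (hl1 : 1 ≤ l)
    (hl : l ≤ L) {C p q : ℝ} (hC : K ≤ C) (hp : α + 1 ≤ p)
    (h : ErrorBound α hα β R l q T n C p P Q) {t : ℕ} (ht : 1 ≤ t) (ht' : t ≤ n ^ l) :
    HasOrder R (correction α hα n Q l q t) (max β (kappa α hα β l q))
      (2 * C * (n : ℝ) ^ (-((l : ℝ) * (1 + α))) * (1 + T) ^ p) := by
  have hT := hsys.T_pos
  have hK := hsys.one_le
  have hC0 : 0 ≤ C := by linarith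
  have h1 := (hsys.stepErr_hasOrder hα hl1 hl hC hp ht ht').mono (le_max_left β (kappa α hα β l q))
    le_rfl (by positivity)
  obtain ⟨u, rfl⟩ := Nat.exists_eq_add_of_le' ht
  have h2 := h1.sub (h.low u ht')
  have e : correction α hα n Q l q (u + 1)
      = stepErr (P l) (Q l) (u + 1) - (P l u (u + 1) - Qhat α hα n Q l q u) :=
    Op.sub_eq_sub_sub _ _ _
  rw [e]
  exact h2.mono le_rfl (le_of_eq (by ring)) (by positivity)

theorem ErrorBound.stepErr_sub_correction_hasOrder {d : ℕ} {α : ℝ} {hα : 0 < α} {β R n : ℕ}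
    {T : ℝ} {P Q : ℕ → ℕ → ℕ → Op d} {l : ℕ} (hT : 0 ≤ T) {C p q : ℝ} (hC : 0 ≤ C)
    (h : ErrorBound α hα β R l q T n C p P Q) {t : ℕ} (ht : 1 ≤ t) (ht' : t ≤ n ^ l) :
    HasOrder R (stepErr (P l) (Q l) t - correction α hα n Q l q t) (max β (kappa α hα β l q))
      (2 * C * (n : ℝ) ^ (-q) * (1 + T) ^ p) := by
  obtain ⟨u, rfl⟩ := Nat.exists_eq_add_of_le' ht
  have e : stepErr (P l) (Q l) (u + 1) - correction α hα n Q l q (u + 1)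
      = P l u (u + 1) - Qhat α hα n Q l q u := Op.sub_sub_cancel_right _ _ _
  rw [e]
  refine (h.high u ht').mono (le_max_right _ _) ?_ (by positivity)
  have : 0 ≤ C * (n : ℝ) ^ (-q) * (1 + T) ^ p := by positivity
  linarith

/-- The superfluous factor 2 gives step errors and corrections the same `ε`, as the comparison of
their chains requires. -/
theorem GridSystem.chainBound_stepErr {d : ℕ} {α : ℝ} (hα : 0 < α) {β R L n : ℕ} {K T : ℝ}
    {P Q : ℕ → ℕ → ℕ → Op d} (hsys : GridSystem α β R L K T n P Q) {l : ℕ} (hl1 : 1 ≤ l)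
    (hl : l ≤ L) {C p : ℝ} (hC : K ≤ C) (hp : α + 1 ≤ p) {e b : ℕ} (he : e ≤ n ^ l)
    (hb : β ≤ b) {F : ℕ → Op d} (hF : ∀ j ≤ e, HasOrder R (F j) 0 K) :
    ChainBound R e b K (2 * C * (n : ℝ) ^ (-((l : ℝ) * (1 + α))) * (1 + T) ^ p) (Q l)
      (stepErr (P l) (Q l)) F := by
  have hT := hsys.T_pos
  have hK := hsys.one_le
  have hC0 : 0 ≤ C := by linarith
  refine ⟨hK, by positivity, fun j k hjk hke => hsys.ordQ l hl1 hl j k hjk (hke.trans he), hF,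
    fun t ht hte => ?_⟩
  refine (hsys.stepErr_hasOrder hα hl1 hl hC hp ht (hte.trans he)).mono hb ?_ (by positivity)
  have : 0 ≤ C * (n : ℝ) ^ (-((l : ℝ) * (1 + α))) * (1 + T) ^ p := by positivity
  linarith

theorem ErrorBound.chainBound_correction {d : ℕ} {α : ℝ} {hα : 0 < α} {β R L n : ℕ} {K T : ℝ}
    {P Q : ℕ → ℕ → ℕ → Op d} (hsys : GridSystem α β R L K T n P Q) {l : ℕ} (hl1 : 1 ≤ l)
    (hl : l ≤ L) {C p q : ℝ} (hC : K ≤ C) (hp : α + 1 ≤ p)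
    (h : ErrorBound α hα β R l q T n C p P Q) {e : ℕ} (he : e ≤ n ^ l)
    {F : ℕ → Op d} (hF : ∀ j ≤ e, HasOrder R (F j) 0 K) :
    ChainBound R e (max β (kappa α hα β l q)) K
      (2 * C * (n : ℝ) ^ (-((l : ℝ) * (1 + α))) * (1 + T) ^ p) (Q l)
      (correction α hα n Q l q) F := by
  have hT := hsys.T_pos
  have hK := hsys.one_le
  have hC0 : 0 ≤ C := by linarith
  exact ⟨hK, by positivity, fun j k hjk hke => hsys.ordQ l hl1 hl j k hjk (hke.trans he), hF,
    fun t ht hte => h.correction_hasOrder hsys hl1 hl hC hp ht (hte.trans he)⟩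

theorem succ_block_le {n l k : ℕ} (hk : k < n ^ l) : k * n + n ≤ n ^ (l + 1) := by
  rw [pow_succ, ← Nat.succ_mul]; exact Nat.mul_le_mul_right n hk

theorem le_kappa {α : ℝ} (hα : 0 < α) (β l : ℕ) (μ : ℝ) :
    mOrd α l μ * β ≤ kappa α hα β l μ := by
  rw [kappa, mul_comm]; exact le_max_left _ _

/-- Chains mix step errors, losing `β`, with corrections, losing up to the maximum; if the maximum
is `β`, the entry `β m` of `kappa` covers it. -/
theorem mul_max_le_kappa {α : ℝ} (hα : 0 < α) (β l : ℕ) (μ : ℝ) (i : Fin (mOrd α l μ - 1)) :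
    ((i : ℕ) + 1) * max β (kappa α hα β (l + 1) (qOrd α (i + 1) l μ)) ≤ kappa α hα β l μ := by
  have hi := i.2
  rcases max_choice β (kappa α hα β (l + 1) (qOrd α (i + 1) l μ)) with h | h <;> rw [h]
  · exact (Nat.mul_le_mul_right β (by omega)).trans (le_kappa hα β l μ)
  · conv_rhs => rw [kappa]
    exact le_max_of_le_right (Finset.le_sup (f := fun i : Fin (mOrd α l μ - 1) =>
      ((i : ℕ) + 1) * kappa α hα β (l + 1) (qOrd α (i + 1) l μ)) (Finset.mem_univ i))

/-- The error of order `μ`, from the errors on the next grid. -/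
theorem error_high {d : ℕ} {α : ℝ} (hα : 0 < α) {β R L n : ℕ} {K T : ℝ}
    {P Q : ℕ → ℕ → ℕ → Op d} (hsys : GridSystem α β R L K T n P Q) {l : ℕ} (hl : l + 1 ≤ L)
    {μ : ℝ} (hm : 1 ≤ mOrd α l μ) {C p : ℝ} (hC : K ≤ C) (hp : α + 1 ≤ p)
    (h : ∀ i : Fin (mOrd α l μ - 1),
      ErrorBound α hα β R (l + 1) (qOrd α (i + 1) l μ) T n C p P Q)
    {k : ℕ} (hk : k < n ^ l) :
    HasOrder R (P l k (k + 1) - Qhat α hα n Q l μ k) (kappa α hα β l μ)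
      (K * (2 * K * C * (1 + T) ^ p) ^ mOrd α l μ * ((mOrd α l μ : ℝ) ^ 2 + 1)
        * (n : ℝ) ^ (-μ)) := by
  have hT := hsys.T_pos
  have hK := hsys.one_le
  have hC0 : 0 ≤ C := by linarith
  have he := succ_block_le hk
  have hU : 1 ≤ (1 + T) ^ p := Real.one_le_rpow (by linarith) (by linarith)
  set V := 2 * K * C * (1 + T) ^ p with hV
  have hV1 : 1 ≤ V := by
    have : 1 ≤ K * C := one_le_mul_of_one_le_of_one_le hK (hK.trans hC)
    have : 1 ≤ K * C * (1 + T) ^ p := one_le_mul_of_one_le_of_one_le this hU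
    rw [hV]; nlinarith
  have hFQ : ∀ j ≤ k * n + n, HasOrder R (Q (l + 1) j (k * n + n)) 0 K := fun j hj =>
    hsys.ordQ (l + 1) (by omega) hl j _ hj he
  have hFP : ∀ j ≤ k * n + n, HasOrder R (P (l + 1) j (k * n + n)) 0 K := fun j hj =>
    hsys.ordP (l + 1) j _ hj he
  have key := error_size hα hsys hl hm hk (isSizeRel_hasOrder R (kappa α hα β l μ))
    (X := fun i => (((i : ℕ) + 1 : ℕ) * (V * (n : ℝ) ^ (-qOrd α (i + 1) l μ)) * K
          * (V * (n : ℝ) ^ (-(((l + 1 : ℕ) : ℝ) * (1 + α)))) ^ (i : ℕ)))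
    (Y := K * (V * (n : ℝ) ^ (-(((l + 1 : ℕ) : ℝ) * (1 + α)))) ^ mOrd α l μ)
    (fun i => by positivity) (by positivity) (fun i ts hts hlen => ?_) (fun ts hts hlen => ?_)
  · exact key.2.mono le_rfl (sum_sizes_le hα l hsys.n_pos hK hV1 hm) (by positivity)
  · have c1 := hsys.chainBound_stepErr hα (by omega) hl hC hp he
      (le_max_left β (kappa α hα β (l + 1) (qOrd α (i + 1) l μ))) hFQ
    have c2 := (h i).chainBound_correction hsys (by omega) hl hC hp he hFQ
    have c3 := c1.hasOrder_sub c2 (by positivity) (fun t ht ht' =>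
      (h i).stepErr_sub_correction_hasOrder hT.le hC0 ht (ht'.trans he)) hts
    refine ⟨by positivity, c3.mono ?_ (le_of_eq ?_) (by positivity)⟩
    · rw [hlen]; exact mul_max_le_kappa hα β l μ i
    · rw [hlen, Nat.add_sub_cancel, hV]; ring
  · have c1 := hsys.chainBound_stepErr hα (by omega) hl hC hp he (le_refl β) hFP
    refine ⟨by positivity, (c1.hasOrder hts).mono ?_ (le_of_eq ?_) (by positivity)⟩
    · rw [hlen]; exact le_kappa hα β l μ
    · rw [hlen, hV]; ring

theorem Qhat_of_mOrd_le_one {d : ℕ} {α : ℝ} (hα : 0 < α) {n : ℕ} (Q : ℕ → ℕ → ℕ → Op d) {l : ℕ}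
    {μ : ℝ} (hm : mOrd α l μ ≤ 1) (k : ℕ) :
    Qhat α hα n Q l μ k = Q (l + 1) (k * n) (k * n + n) := by
  rw [Qhat_eq]
  have : IsEmpty (Fin (mOrd α l μ - 1)) := by
    rw [Nat.sub_eq_zero_of_le hm]; infer_instance
  rw [Finset.univ_eq_empty, Finset.sum_empty, add_zero]

theorem Op.sub_eq_of_eq_add {d : ℕ} {p a b : Op d} (h : p = a + b) : p - a = b := by
  rw [h]
  exact add_sub_cancel_left a b

/-- The error of `Q` on the next grid. -/
theorem error_low {d : ℕ} {α : ℝ} (hα : 0 < α) {β R L n : ℕ} {K T : ℝ}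
    {P Q : ℕ → ℕ → ℕ → Op d} (hsys : GridSystem α β R L K T n P Q) {l : ℕ} (hl : l + 1 ≤ L)
    {p : ℝ} (hp : α + 1 ≤ p) {k : ℕ} (hk : k < n ^ l) :
    HasOrder R (P l k (k + 1) - Q (l + 1) (k * n) (k * n + n)) β
      (2 * K ^ 3 * (n : ℝ) ^ (-((l : ℝ) * (1 + α))) * (1 + T) ^ p) := by
  have hT := hsys.T_pos
  have hK := hsys.one_le
  have he := succ_block_le hk
  have hn1 : (1 : ℝ) ≤ n := by exact_mod_cast hsys.n_pos
  have hn0 : (0 : ℝ) < n := by linarith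
  have hFP : ∀ j ≤ k * n + n, HasOrder R (P (l + 1) j (k * n + n)) 0 K := fun j hj =>
    hsys.ordP (l + 1) j _ hj he
  have hexp := expansion (hsys.semiP (l + 1)) (hsys.semiQ (l + 1) (by omega) hl) he 1
    (s := k * n) (by omega)
  rw [Finset.sum_range_one, chainSum_zero] at hexp
  rw [hsys.refine_eq, Op.sub_eq_of_eq_add hexp]
  have c1 := hsys.chainBound_stepErr hα (by omega) hl le_rfl hp he (le_refl β) hFP
  set ε := 2 * K * (n : ℝ) ^ (-(((l + 1 : ℕ) : ℝ) * (1 + α))) * (1 + T) ^ p with hε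
  have key := (isSizeRel_hasOrder R β).sum_powersetCard 1 (k * n) n
    (A := fun t => chainEnd (Q (l + 1)) (stepErr (P (l + 1)) (Q (l + 1)))
      (fun j => P (l + 1) j (k * n + n)) (k * n) (t.sort (· ≤ ·)))
    (x := K * (K * ε)) (by positivity) (fun t ht => ⟨by positivity, ?_⟩)
  · refine key.2.mono le_rfl ?_ (by positivity)
    have e : (n : ℝ) ^ 1 * (n : ℝ) ^ (-(((l + 1 : ℕ) : ℝ) * (1 + α)))
        ≤ (n : ℝ) ^ (-((l : ℝ) * (1 + α))) := by
      rw [← Real.rpow_natCast, ← Real.rpow_add hn0]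
      refine Real.rpow_le_rpow_of_exponent_le hn1 ?_
      push_cast
      linarith
    calc (n : ℝ) ^ 1 * (K * (K * ε))
        = 2 * K ^ 3 * ((n : ℝ) ^ 1 * (n : ℝ) ^ (-(((l + 1 : ℕ) : ℝ) * (1 + α)))) * (1 + T) ^ p := by
          rw [hε]; ring
      _ ≤ _ := by gcongr
  · rw [Finset.mem_powersetCard] at ht
    have hlen : (t.sort (· ≤ ·)).length = 1 := by rw [Finset.length_sort, ht.2]
    have := c1.hasOrder (admissible_sort (by omega) ht.1)
    rw [hlen, one_mul, pow_one] at this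
    exact this

/-- Errors on the grid `l`, with constants uniform in the grid system. -/
theorem exists_errorBound {α : ℝ} (hα : 0 < α) (l : ℕ) (μ : ℝ) :
    ∃ p : ℝ, 0 ≤ p ∧ ∀ (d β R : ℕ) (K : ℝ), 1 ≤ K → ∃ C : ℝ, 0 ≤ C ∧
      ∀ (L : ℕ) (T : ℝ) (n : ℕ) (P Q : ℕ → ℕ → ℕ → Op d), GridSystem α β R L K T n P Q →
        l + depth α l μ + 1 ≤ L → ErrorBound α hα β R l μ T n C p P Q := by
  induction hN : depth α l μ using Nat.strong_induction_on generalizing l μ with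
  | _ N ih =>
  subst hN
  set m := mOrd α l μ with hm
  have ih' := fun i : Fin (m - 1) =>
    ih _ (depth_lt hα l μ i) (l + 1) (qOrd α (i + 1) l μ) rfl
  -- Exponents are fixed before `d`, `β`, `R` and `K`, on which they must not depend.
  choose pf hpf hf using ih'
  set p₀ := α + 1 + ∑ i, pf i with hp₀
  have hp₀α : α + 1 ≤ p₀ := by
    have := Finset.sum_nonneg fun i (_ : i ∈ Finset.univ) => hpf i
    linarith
  have hp₀i : ∀ i, pf i ≤ p₀ := fun i => by
    have := Finset.single_le_sum (fun i _ => hpf i) (Finset.mem_univ i)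
    linarith
  have hp₀0 : 0 ≤ p₀ := by linarith
  -- A chain of `m` increments yields `((1 + T) ^ p₀) ^ m`; the extra `1` keeps the exponent above
  -- `p₀` when `m = 0`.
  refine ⟨p₀ * (m + 1), by positivity, fun d β R K hK => ?_⟩
  have hf' := fun i => hf i d β R K hK
  choose Cf hCf hf' using hf'
  set C₀ := K + ∑ i, Cf i with hC₀
  have hC₀K : K ≤ C₀ := by
    have := Finset.sum_nonneg fun i (_ : i ∈ Finset.univ) => hCf i
    linarith
  have hC₀i : ∀ i, Cf i ≤ C₀ := fun i => by
    have := Finset.single_le_sum (fun i _ => hCf i) (Finset.mem_univ i)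
    linarith
  have hC₀0 : 0 ≤ C₀ := by linarith
  set c₁ := K * (2 * K * C₀) ^ m * ((m : ℝ) ^ 2 + 1) with hc₁
  have hc₁0 : 0 ≤ c₁ := by positivity
  refine ⟨c₁ + 2 * K ^ 3, by positivity, fun L T n P Q hsys hL => ?_⟩
  have hT := hsys.T_pos
  have hn1 : (1 : ℝ) ≤ n := by exact_mod_cast hsys.n_pos
  have hn0 : (0 : ℝ) < n := by linarith
  have hpow : (1 + T) ^ p₀ ≤ (1 + T) ^ (p₀ * (m + 1)) :=
    Real.rpow_le_rpow_of_exponent_le (by linarith)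
      (le_mul_of_one_le_right hp₀0 (by linarith [Nat.cast_nonneg (α := ℝ) m]))
  have hpow1 : 1 ≤ (1 + T) ^ (p₀ * (m + 1)) := Real.one_le_rpow (by linarith) (by positivity)
  have hlow : m ≤ 1 → ∀ k < n ^ l, HasOrder R (P l k (k + 1) - Qhat α hα n Q l μ k) β
      ((c₁ + 2 * K ^ 3) * (n : ℝ) ^ (-((l : ℝ) * (1 + α))) * (1 + T) ^ (p₀ * (m + 1))) := by
    intro hm1 k hk
    rw [Qhat_of_mOrd_le_one hα Q hm1]
    refine (error_low hα hsys (by omega) hp₀α hk).mono le_rfl ?_ (by positivity)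
    gcongr
    linarith
  have hhigh : ∀ k < n ^ l, HasOrder R (P l k (k + 1) - Qhat α hα n Q l μ k)
      (kappa α hα β l μ) ((c₁ + 2 * K ^ 3) * (n : ℝ) ^ (-μ) * (1 + T) ^ (p₀ * (m + 1))) := by
    intro k hk
    -- If `m = 0` then `μ ≤ 0` and `n ^ (-μ) ≥ 1`, so boundedness of `P` and `Q` is enough.
    rcases Nat.eq_zero_or_pos m with hm0 | hm1
    · rw [Qhat_of_mOrd_le_one hα Q (by omega), hsys.refine_eq]
      have he := succ_block_le hk
      have h1 := (hsys.ordP (l + 1) (k * n) (k * n + n) (by omega) he).sub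
        (hsys.ordQ (l + 1) (by omega) (by omega) (k * n) (k * n + n) (by omega) he)
      refine h1.mono (Nat.zero_le _) ?_ (by positivity)
      have hμ : μ ≤ 0 := by
        have : μ / ((1 + α) * l + α) ≤ 0 := by
          rw [← Nat.ceil_eq_zero]; exact hm0
        by_contra! hcon
        have : 0 < μ / ((1 + α) * l + α) := by positivity
        linarith
      have h2 : 1 ≤ (n : ℝ) ^ (-μ) := Real.one_le_rpow hn1 (by linarith)
      have h3 : K + K ≤ c₁ + 2 * K ^ 3 := by
        have : K ≤ K ^ 3 := le_self_pow₀ hK (by norm_num)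
        linarith
      have h4 : 1 ≤ (n : ℝ) ^ (-μ) * (1 + T) ^ (p₀ * (m + 1)) :=
        one_le_mul_of_one_le_of_one_le h2 hpow1
      rw [mul_assoc]
      exact h3.trans (le_mul_of_one_le_right (by positivity) h4)
    · have h1 := error_high hα hsys (by omega) hm1 hC₀K hp₀α (fun i =>
        (hf' i L T n P Q hsys (by
          have := depth_lt hα l μ i
          omega)).mono hT.le (hC₀i i) hC₀0 (hp₀i i)) hk
      refine h1.mono le_rfl ?_ (by positivity)
      have e : ((1 + T) ^ p₀) ^ m ≤ (1 + T) ^ (p₀ * (m + 1)) := by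
        rw [← Real.rpow_natCast, ← Real.rpow_mul (by linarith)]
        exact Real.rpow_le_rpow_of_exponent_le (by linarith)
          (mul_le_mul_of_nonneg_left (by linarith) hp₀0)
      calc K * (2 * K * C₀ * (1 + T) ^ p₀) ^ m * ((m : ℝ) ^ 2 + 1) * (n : ℝ) ^ (-μ)
          = c₁ * (n : ℝ) ^ (-μ) * ((1 + T) ^ p₀) ^ m := by
            rw [hc₁, mul_pow (2 * K * C₀)]; ring
        _ ≤ (c₁ + 2 * K ^ 3) * (n : ℝ) ^ (-μ) * (1 + T) ^ (p₀ * (m + 1)) := by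
            gcongr
            linarith [pow_nonneg (zero_le_one.trans hK) 3]
  refine ⟨hhigh, fun k hk => ?_⟩
  -- If `m ≥ 2` then `μ > l(1+α)` and the bound `high` is the stronger one; otherwise `Qhat` is just
  -- `Q` on the next grid.
  rcases Nat.lt_or_ge 1 m with hm2 | hm1
  · refine (hhigh k hk).mono (le_max_right _ _) ?_ (by positivity)
    have hμ : (l : ℝ) * (1 + α) ≤ μ := by
      have : ((1 : ℕ) : ℝ) < μ / ((1 + α) * l + α) := Nat.lt_ceil.1 hm2
      rw [Nat.cast_one, one_lt_div (by positivity)] at this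
      linarith
    gcongr
  · exact (hlow hm1 k hk).mono (le_max_left _ _) le_rfl (by positivity)

/-! ### The error on the coarsest grid, with regularization -/

theorem mul_max_le_qReg {α : ℝ} (hα : 0 < α) (β : ℕ) (ν : ℝ) {i : ℕ} (hi : 1 ≤ i)
    (him : i ≤ mOrd α 0 ν) :
    i * max β (kappa α hα β 1 (qOrd α i 0 ν)) ≤ qReg α hα β ν :=
  Finset.le_sup (f := fun i => i * max β (kappa α hα β 1 (qOrd α i 0 ν)))
    (Finset.mem_Icc.2 ⟨hi, him⟩)

/-- In units of `T / n`, this gap is the threshold in the definition of `Tnu`. -/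
theorem hasGap_of_length_le {n m : ℕ} (hmn : m < n) {e s : ℕ} (hes : e = s + n) {ts : List ℕ}
    (hts : Admissible e s ts) (hlen : ts.length ≤ m) :
    HasGap (((n : ℝ) - m) / ((m : ℝ) + 1)) e s ts := by
  refine hasGap_of_le hts ?_
  have hmn' : (m : ℝ) < n := by exact_mod_cast hmn
  have hlen' : (ts.length : ℝ) ≤ m := by exact_mod_cast hlen
  have hg : 0 ≤ ((n : ℝ) - m) / ((m : ℝ) + 1) := by
    apply div_nonneg <;> linarith [Nat.cast_nonneg (α := ℝ) m]
  have h1 : ((ts.length : ℝ) + 1) * (((n : ℝ) - m) / ((m : ℝ) + 1)) ≤ n - m := by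
    calc _ ≤ ((m : ℝ) + 1) * (((n : ℝ) - m) / ((m : ℝ) + 1)) := by gcongr
      _ = n - m := by field_simp
  rw [hes]
  push_cast
  linarith

/-- The budget `qReg` is the largest total loss of a chain with at most `m` increments. The long gap
of a remainder chain may be its last factor, which is why `P` must regularize too. -/
theorem error_gainsOrder {d : ℕ} {α : ℝ} (hα : 0 < α) {β L n : ℕ} {K T ν : ℝ}
    {P Q : ℕ → ℕ → ℕ → Op d} (hsys : GridSystem α β (qReg α hα β ν) L K T n P Q) (hL : 1 ≤ L)
    (hm : 1 ≤ mOrd α 0 ν) (hmn : mOrd α 0 ν < n) {C p G : ℝ} (hC : K ≤ C) (hp : α + 1 ≤ p)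
    (h : ∀ i : Fin (mOrd α 0 ν - 1),
      ErrorBound α hα β (qReg α hα β ν) 1 (qOrd α (i + 1) 0 ν) T n C p P Q)
    (hGQ : GapSmoothing (qReg α hα β ν) n (((n : ℝ) - mOrd α 0 ν) / ((mOrd α 0 ν : ℝ) + 1)) G
      (Q 1) (fun j => Q 1 j n))
    (hGP : GapSmoothing (qReg α hα β ν) n (((n : ℝ) - mOrd α 0 ν) / ((mOrd α 0 ν : ℝ) + 1)) G
      (Q 1) (fun j => P 1 j n)) :
    GainsOrder (P 0 0 1 - Qhat α hα n Q 0 ν 0) 0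
      (G * (K * (2 * K * C * (1 + T) ^ p) ^ mOrd α 0 ν * ((mOrd α 0 ν : ℝ) ^ 2 + 1)
        * (n : ℝ) ^ (-ν))) := by
  have hT := hsys.T_pos
  have hK := hsys.one_le
  have hG := hGQ.nonneg
  have hC0 : 0 ≤ C := by linarith
  have he : n ≤ n ^ 1 := by simp
  have hU : 1 ≤ (1 + T) ^ p := Real.one_le_rpow (by linarith) (by linarith)
  set V := 2 * K * C * (1 + T) ^ p with hV
  have hV1 : 1 ≤ V := by
    have : 1 ≤ K * C := one_le_mul_of_one_le_of_one_le hK (hK.trans hC)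
    have : 1 ≤ K * C * (1 + T) ^ p := one_le_mul_of_one_le_of_one_le this hU
    rw [hV]; nlinarith
  have hFQ : ∀ j ≤ n, HasOrder (qReg α hα β ν) (Q 1 j n) 0 K := fun j hj =>
    hsys.ordQ 1 le_rfl hL j _ hj he
  have hFP : ∀ j ≤ n, HasOrder (qReg α hα β ν) (P 1 j n) 0 K := fun j hj =>
    hsys.ordP 1 j _ hj he
  have e0 : 0 * n + n = n := by omega
  have e1 : 0 * n = 0 := Nat.zero_mul n
  have key := error_size hα hsys (l := 0) (by omega) hm (k := 0) (by simp)
    (isSizeRel_gainsOrder 0)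
    (X := fun i => G * (((i : ℕ) + 1 : ℕ) * (V * (n : ℝ) ^ (-qOrd α (i + 1) 0 ν)) * K
          * (V * (n : ℝ) ^ (-(((0 + 1 : ℕ) : ℝ) * (1 + α)))) ^ (i : ℕ)))
    (Y := G * (K * (V * (n : ℝ) ^ (-(((0 + 1 : ℕ) : ℝ) * (1 + α)))) ^ mOrd α 0 ν))
    (fun i => by positivity) (by positivity) (fun i ts hts hlen => ?_) (fun ts hts hlen => ?_)
  · refine key.mono ?_
    refine le_trans (le_of_eq ?_) (mul_le_mul_of_nonneg_left
      (sum_sizes_le hα 0 hsys.n_pos hK hV1 hm) hG)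
    rw [mul_add G, Finset.mul_sum]
    refine congrArg₂ (· + ·) (Finset.sum_congr rfl fun i _ => ?_) ?_ <;> ring
  · rw [e0, e1] at hts ⊢
    have c1 := hsys.chainBound_stepErr hα le_rfl hL hC hp he
      (le_max_left β (kappa α hα β 1 (qOrd α (i + 1) 0 ν))) hFQ
    have c2 := (h i).chainBound_correction hsys le_rfl hL hC hp he hFQ
    have hi : (i : ℕ) + 1 ≤ mOrd α 0 ν := by have := i.2; omega
    have c3 := c1.gainsOrder_sub c2 hGQ (by positivity) (fun t ht ht' =>
      (h i).stepErr_sub_correction_hasOrder hT.le hC0 ht (ht'.trans he)) hts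
      (hasGap_of_length_le hmn (by omega) hts (by omega)) (a := 0) (by
        rw [hlen, zero_add]
        exact mul_max_le_qReg hα β ν (by omega) hi)
    refine c3.mono (mul_le_mul_of_nonneg_left (le_of_eq ?_) hG)
    rw [hlen, Nat.add_sub_cancel, hV, zero_add]; ring
  · rw [e0, e1] at hts ⊢
    have c1 := hsys.chainBound_stepErr hα le_rfl hL hC hp he (le_refl β) hFP
    refine (c1.gainsOrder hGP hts (hasGap_of_length_le hmn (by omega) hts hlen.le) (a := 0) (by
      rw [hlen, zero_add]
      exact (Nat.mul_le_mul_left _ (le_max_left _ _)).trans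
        (mul_max_le_qReg hα β ν hm le_rfl))).mono (mul_le_mul_of_nonneg_left (le_of_eq ?_) hG)
    rw [hlen, hV, zero_add]; ring

/-! ### Crude bounds in the uniform norm -/

theorem isBPCont_chainEnd {d e : ℕ} {Q : ℕ → ℕ → Op d} {Λ F : ℕ → Op d} {K c : ℝ}
    (hQ : ∀ j k, j ≤ k → k ≤ e → IsBPCont (Q j k) K) (hF : ∀ j ≤ e, IsBPCont (F j) K)
    (hΛ : ∀ t, 1 ≤ t → t ≤ e → IsBPCont (Λ t) c) {s : ℕ} {ts : List ℕ}
    (hts : Admissible e s ts) :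
    IsBPCont (chainEnd Q Λ F s ts) ((K * c) ^ ts.length * K) := by
  induction ts generalizing s with
  | nil => simpa [chainEnd] using hF s hts.start_le
  | cons t ts ih =>
    obtain ⟨h1, h2, h3⟩ := hts.cons
    have := ((hQ s (t - 1) (by omega) (by omega)).mul (hΛ t (by omega) h2)).mul (ih h3)
    simp only [chainEnd, List.length_cons]
    convert this using 1
    ring

/-- `Qhat` is bounded in the uniform norm, with a constant depending on `n`. -/
theorem exists_isBPCont_Qhat {α : ℝ} (hα : 0 < α) (n : ℕ) (K : ℝ) (l : ℕ) (μ : ℝ) :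
    ∃ c : ℝ, ∀ (d L : ℕ) (Q : ℕ → ℕ → ℕ → Op d),
      (∀ l', 1 ≤ l' → l' ≤ L → ∀ j k, j ≤ k → k ≤ n ^ l' → IsBPCont (Q l' j k) K) →
      l + depth α l μ + 1 ≤ L → ∀ k < n ^ l, IsBPCont (Qhat α hα n Q l μ k) c := by
  induction hN : depth α l μ using Nat.strong_induction_on generalizing l μ with
  | _ N ih =>
  subst hN
  have ih' := fun i : Fin (mOrd α l μ - 1) =>
    ih _ (depth_lt hα l μ i) (l + 1) (qOrd α (i + 1) l μ) rfl
  choose cf hcf using ih'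
  refine ⟨K + ∑ i : Fin (mOrd α l μ - 1), (n.choose ((i : ℕ) + 1) : ℝ)
    * ((K * (cf i + K)) ^ ((i : ℕ) + 1) * K), fun d L Q hQ hL k hk => ?_⟩
  have he := succ_block_le hk
  have hQ' : ∀ j k', j ≤ k' → k' ≤ k * n + n → IsBPCont (Q (l + 1) j k') K := fun j k' h h' =>
    hQ (l + 1) (by omega) (by omega) j k' h (h'.trans he)
  rw [Qhat_eq]
  refine (hQ' _ _ (by omega) le_rfl).add (IsBPCont.sum _ fun i _ => ?_)
  have hcard : (n.choose ((i : ℕ) + 1) : ℝ) * ((K * (cf i + K)) ^ ((i : ℕ) + 1) * K)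
      = ∑ t ∈ Finset.powersetCard ((i : ℕ) + 1) (Finset.Ioc (k * n) (k * n + n)),
          (K * (cf i + K)) ^ ((i : ℕ) + 1) * K := by
    rw [Finset.sum_const, Finset.card_powersetCard, Nat.card_Ioc, Nat.add_sub_cancel_left,
      nsmul_eq_mul]
  rw [hcard]
  refine IsBPCont.sum _ fun t ht => ?_
  rw [Finset.mem_powersetCard] at ht
  have hd := depth_lt hα l μ i
  have := isBPCont_chainEnd (Λ := correction α hα n Q (l + 1) (qOrd α (i + 1) l μ))
    (c := cf i + K) (F := fun j => Q (l + 1) j (k * n + n)) hQ' (fun j hj => hQ' j _ hj le_rfl)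
    (fun u hu hu' => (hcf i d L Q hQ (by omega) (u - 1) (by omega)).sub
      (hQ' (u - 1) u (by omega) hu'))
    (admissible_sort (by omega) ht.1)
  rwa [Finset.length_sort, ht.2] at this

/-! ### From the hypotheses to a grid system -/

/-- A common bound of the constants `K r`, `r ≤ R`. -/
def maxConst (K : ℕ → ℝ) (R : ℕ) : ℝ := 1 + ∑ r ∈ Finset.range (R + 1), |K r|

theorem one_le_maxConst (K : ℕ → ℝ) (R : ℕ) : 1 ≤ maxConst K R := by
  have : 0 ≤ ∑ r ∈ Finset.range (R + 1), |K r| := Finset.sum_nonneg fun _ _ => abs_nonneg _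
  unfold maxConst; linarith

theorem le_maxConst (K : ℕ → ℝ) {r R : ℕ} (h : r ≤ R) : K r ≤ maxConst K R := by
  have h1 := Finset.single_le_sum (f := fun r => |K r|) (fun _ _ => abs_nonneg _)
    (Finset.mem_range.2 (Nat.lt_succ_of_le h))
  have h2 := le_abs_self (K r)
  unfold maxConst; linarith

theorem HasDual.isDualImage {d : ℕ} {A : Op d} {ψ : E d → ℝ} (h : HasDual A ψ) :
    IsDualImage A ψ (dual A ψ) := by
  rw [dual, dif_pos h]
  exact h.choose_spec.2

theorem hasOrder_of_propagates {d : ℕ} {ι : Type} [Preorder ι] {S : Set ι} {K : ℕ → ℝ}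
    {A : ι → ι → Op d} (h : Propagates S K A) (h' : PropagatesDual S K A) (R : ℕ) {s t : ι}
    (hs : s ∈ S) (ht : t ∈ S) (hst : s ≤ t) : HasOrder R (A s t) 0 (maxConst K R) where
  mem f hf r := (h s hs t ht hst r f (hf r)).1
  le f hf r hr := by
    rw [zero_add] at *
    exact (h s hs t ht hst r f (hf r)).2.trans
      (mul_le_mul_of_nonneg_right (le_maxConst K hr) (normSup_nonneg _ _))
  dual ψ hψ := ⟨dual (A s t) ψ, fun r => (h' s hs t ht hst r ψ (hψ r)).2.1,
    (h' s hs t ht hst 0 ψ (hψ 0)).1.isDualImage, fun r hr => by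
      rw [zero_add] at *
      exact (h' s hs t ht hst r ψ (hψ r)).2.2.trans
        (mul_le_mul_of_nonneg_right (le_maxConst K hr) (normL1_nonneg _ _))⟩

theorem hasOrder_sub_of_le {d R β : ℕ} {A B : Op d} {K : ℕ → ℝ} {M x : ℝ} (hx : 0 ≤ x)
    (hA : HasOrder R A 0 M) (hB : HasOrder R B 0 M)
    (hdA : ∀ ψ, IsSmoothC1 ψ → HasDual A ψ ∧ IsSmoothC1 (dual A ψ))
    (hdB : ∀ ψ, IsSmoothC1 ψ → HasDual B ψ ∧ IsSmoothC1 (dual B ψ))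
    (h : ∀ (r : ℕ) (f : Mb d), IsCb (β + r) (f : E d → ℝ) →
      normSup r ((A f : E d → ℝ) - (B f : E d → ℝ)) ≤ K r * normSup (β + r) (f : E d → ℝ) * x)
    (h' : ∀ (r : ℕ) (ψ : E d → ℝ), IsC1 (β + r) ψ →
      normL1 r (dual A ψ - dual B ψ) ≤ K r * normL1 (β + r) ψ * x) :
    HasOrder R (A - B) β (maxConst K R * x) where
  mem f hf := (hA.mem f hf).sub (hB.mem f hf)
  le f hf r hr := by
    refine (h r f (hf _)).trans ?_
    rw [mul_right_comm]
    exact mul_le_mul_of_nonneg_right (mul_le_mul_of_nonneg_right (le_maxConst K (by omega)) hx)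
      (normSup_nonneg _ _)
  dual ψ hψ := by
    refine ⟨dual A ψ - dual B ψ, (hdA ψ hψ).2.sub (hdB ψ hψ).2,
      (hdA ψ hψ).1.isDualImage.sub hψ.integrable (hdA ψ hψ).2.integrable (hdB ψ hψ).2.integrable
        (hdB ψ hψ).1.isDualImage, fun r hr => ?_⟩
    refine (h' r ψ (hψ _)).trans ?_
    rw [mul_right_comm]
    exact mul_le_mul_of_nonneg_right (mul_le_mul_of_nonneg_right (le_maxConst K (by omega)) hx)
      (normL1_nonneg _ _)

/-- The restriction of `P` to the grid of step `δ_n^l`. -/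
def gridP {d : ℕ} (P : ℝ → ℝ → Op d) (T : ℝ) (n l j k : ℕ) : Op d :=
  P (j * step T n l) (k * step T n l)

theorem step_pos {T : ℝ} (hT : 0 < T) {n : ℕ} (hn : 1 ≤ n) (l : ℕ) : 0 < step T n l := by
  have : (0 : ℝ) < n := by exact_mod_cast hn
  unfold step; positivity

theorem grid_mem_Icc {T : ℝ} (hT : 0 < T) {n : ℕ} (hn : 1 ≤ n) {l k : ℕ} (hk : k ≤ n ^ l) :
    (k : ℝ) * step T n l ∈ Set.Icc 0 T := by
  have hn0 : (0 : ℝ) < n := by exact_mod_cast hn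
  have hk' : (k : ℝ) ≤ (n : ℝ) ^ l := by exact_mod_cast hk
  refine ⟨mul_nonneg (Nat.cast_nonneg k) (step_pos hT hn l).le, ?_⟩
  calc (k : ℝ) * step T n l ≤ (n : ℝ) ^ l * step T n l :=
        mul_le_mul_of_nonneg_right hk' (step_pos hT hn l).le
    _ = T := by unfold step; field_simp

theorem grid_mono {T : ℝ} (hT : 0 < T) {n : ℕ} (hn : 1 ≤ n) (l : ℕ) {j k : ℕ} (hjk : j ≤ k) :
    (j : ℝ) * step T n l ≤ k * step T n l :=
  mul_le_mul_of_nonneg_right (by exact_mod_cast hjk) (step_pos hT hn l).le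

theorem gridSystem_of_hypotheses {d : ℕ} {α : ℝ} {β R L n : ℕ} {T : ℝ} {K : ℕ → ℝ}
    {P : ℝ → ℝ → Op d} {Q : ℕ → ℕ → ℕ → Op d} (hT : 0 < T) (hn : 1 ≤ n)
    (hP : IsSemigroupOn (Set.Icc 0 T) P)
    (hQ : ∀ l ∈ Set.Icc 1 L, IsSemigroupOn (Set.Iic (n ^ l)) (Q l))
    (hPp : Propagates (Set.Icc 0 T) K P)
    (hQp : ∀ l ∈ Set.Icc 1 L, Propagates (Set.Iic (n ^ l)) K (Q l))
    (hPd : PropagatesDual (Set.Icc 0 T) K P)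
    (hQd : ∀ l ∈ Set.Icc 1 L, PropagatesDual (Set.Iic (n ^ l)) K (Q l))
    (hs : ∀ l ∈ Set.Icc 1 L, ShortTime T n l K α β P (Q l))
    (hsd : ∀ l ∈ Set.Icc 1 L, ShortTimeDual T n l K α β P (Q l)) :
    GridSystem α β R L (maxConst K R) T n (gridP P T n) Q where
  T_pos := hT
  n_pos := hn
  one_le := one_le_maxConst K R
  semiP l := ⟨fun t ht => hP.refl _ (grid_mem_Icc hT hn ht), fun s u t hsu hut ht =>
    hP.comp _ (grid_mem_Icc hT hn (by omega)) _ (grid_mem_Icc hT hn (by omega)) _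
      (grid_mem_Icc hT hn ht) (grid_mono hT hn l hsu) (grid_mono hT hn l hut)⟩
  -- One step of the grid `l` and `n` steps of the grid `l + 1` have the same endpoints in real
  -- time.
  refine_eq l k := by
    have hn0 : (n : ℝ) ≠ 0 := by exact_mod_cast (show n ≠ 0 by omega)
    have h1 : (k : ℝ) * step T n l = ((k * n : ℕ) : ℝ) * step T n (l + 1) := by
      unfold step; push_cast; field_simp; ring
    have h2 : ((k + 1 : ℕ) : ℝ) * step T n l = ((k * n + n : ℕ) : ℝ) * step T n (l + 1) := by
      unfold step; push_cast; field_simp; ring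
    rw [gridP, gridP, h1, h2]
  semiQ l hl1 hl := ⟨fun t ht => (hQ l ⟨hl1, hl⟩).refl t ht, fun s u t hsu hut ht =>
    (hQ l ⟨hl1, hl⟩).comp s (hsu.trans (hut.trans ht)) u (hut.trans ht) t ht hsu hut⟩
  ordP l j k hjk hk := hasOrder_of_propagates hPp hPd R (grid_mem_Icc hT hn (hjk.trans hk))
    (grid_mem_Icc hT hn hk) (grid_mono hT hn l hjk)
  ordQ l hl1 hl j k hjk hk := hasOrder_of_propagates (hQp l ⟨hl1, hl⟩) (hQd l ⟨hl1, hl⟩) R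
    (hjk.trans hk : j ≤ n ^ l) hk hjk
  err l hl1 hl k hk := by
    have hl' : l ∈ Set.Icc 1 L := ⟨hl1, hl⟩
    have hPk := grid_mem_Icc hT hn (show k ≤ n ^ l by omega)
    have hPk' := grid_mem_Icc hT hn hk
    have hle := grid_mono hT hn l (Nat.le_succ k)
    have hQk : k ∈ Set.Iic (n ^ l) := show k ≤ n ^ l by omega
    refine hasOrder_sub_of_le (M := maxConst K R)
      (Real.rpow_nonneg (step_pos hT hn l).le _)
      (hasOrder_of_propagates hPp hPd R hPk hPk' hle)
      (hasOrder_of_propagates (hQp l hl') (hQd l hl') R hQk hk (Nat.le_succ k))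
      (fun ψ hψ => ⟨(hPd _ hPk _ hPk' hle 0 ψ (hψ 0)).1,
        fun r => (hPd _ hPk _ hPk' hle r ψ (hψ r)).2.1⟩)
      (fun ψ hψ => ⟨(hQd l hl' k hQk (k + 1) hk (Nat.le_succ k) 0 ψ (hψ 0)).1,
        fun r => (hQd l hl' k hQk (k + 1) hk (Nat.le_succ k) r ψ (hψ r)).2.1⟩) ?_ ?_
    · intro r f hf
      have := hs l hl' k hk r f hf
      simpa only [gridP, Nat.cast_add, Nat.cast_one] using this
    · intro r ψ hψ
      have := hsd l hl' k hk r ψ hψ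
      simpa only [gridP, Nat.cast_add, Nat.cast_one] using this

/-! ### Smoothing over long gaps -/

/-- Gaps are whole numbers of steps, so rounding the threshold up to the grid costs nothing. -/
theorem Tnu_le {α T ν : ℝ} {n : ℕ} (hT : 0 < T) (hn : 1 ≤ n) {g : ℕ}
    (hg : ((n : ℝ) - mOrd α 0 ν) / ((mOrd α 0 ν : ℝ) + 1) ≤ g) :
    Tnu α T n ν ≤ g * step T n 1 := by
  refine csInf_le ⟨_, fun t ht => ht.2⟩ ⟨⟨g, rfl⟩, ?_⟩
  have hn0 : (0 : ℝ) < n := by exact_mod_cast hn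
  calc T * ((n : ℝ) - mOrd α 0 ν) / (n * ((mOrd α 0 ν : ℝ) + 1))
      = ((n : ℝ) - mOrd α 0 ν) / ((mOrd α 0 ν : ℝ) + 1) * step T n 1 := by
        unfold step; field_simp
    _ ≤ g * step T n 1 := mul_le_mul_of_nonneg_right hg (step_pos hT hn 1).le

theorem Tnu_pos {α T ν : ℝ} {n : ℕ} (hT : 0 < T) (hmn : mOrd α 0 ν < n) : 0 < Tnu α T n ν := by
  have hn : 1 ≤ n := by omega
  have hn0 : (0 : ℝ) < n := by exact_mod_cast hn
  have hmn' : (mOrd α 0 ν : ℝ) < n := by exact_mod_cast hmn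
  have h0 : 0 < T * ((n : ℝ) - mOrd α 0 ν) / (n * ((mOrd α 0 ν : ℝ) + 1)) :=
    div_pos (mul_pos hT (by linarith)) (by positivity)
  refine h0.trans_le (le_csInf ?_ fun t ht => ht.2)
  obtain ⟨k, hk⟩ := exists_nat_ge
    (T * ((n : ℝ) - mOrd α 0 ν) / (n * ((mOrd α 0 ν : ℝ) + 1)) / step T n 1)
  exact ⟨k * step T n 1, ⟨k, rfl⟩, (div_le_iff₀ (step_pos hT hn 1)).1 hk⟩

theorem isSmoothing_of_regularizesOn {d : ℕ} {ι : Type} [Preorder ι] {S : Set ι} {τ : ι → ℝ}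
    {K : ℕ → ℝ} {R : ℕ} {η : ℝ} (hη : 0 ≤ η) {A : ι → ι → Op d}
    (h : Regularizes S τ K R η A) {s t : ι} (hs : s ∈ S) (ht : t ∈ S) (hst : s < t)
    (hA : HasOrder R (A s t) 0 (maxConst K R)) {x : ℝ} (hx : 0 < x) (hxτ : x ≤ τ t - τ s) :
    IsSmoothing R (((multiIdx d R).card : ℝ) ^ 2 * (maxConst K R / x ^ η)) (A s t) := by
  have hK := one_le_maxConst K R
  refine isSmoothing_of_regularizes (by positivity) hA fun r γ hr f g hf hg => ?_
  refine (h s hs t ht hst r γ hr f g hf hg).trans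
    (mul_le_mul_of_nonneg_right ?_ (supNorm_nonneg _))
  exact div_le_div₀ (by linarith) (le_maxConst K (by omega)) (by positivity)
    (Real.rpow_le_rpow hx.le hxτ hη)

theorem isSmoothing_of_gap {d : ℕ} {α ν : ℝ} {R n : ℕ} {T η : ℝ} {K : ℕ → ℝ} (hη : 0 ≤ η)
    {P : ℝ → ℝ → Op d} {Q : ℕ → ℕ → Op d} (hT : 0 < T) (hmn : mOrd α 0 ν < n)
    (hordP : ∀ j k, j ≤ k → k ≤ n → HasOrder R (gridP P T n 1 j k) 0 (maxConst K R))
    (hordQ : ∀ j k, j ≤ k → k ≤ n → HasOrder R (Q j k) 0 (maxConst K R))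
    (hRQ : Regularizes (Set.Iic (n ^ 1)) (fun k : ℕ => k * step T n 1) K R η Q)
    (hRP : Regularizes (Set.Icc 0 T) (fun t : ℝ => t) K R η P) {j k : ℕ} (hjk : j ≤ k)
    (hk : k ≤ n) (hg : ((n : ℝ) - mOrd α 0 ν) / ((mOrd α 0 ν : ℝ) + 1) ≤ (k : ℝ) - j) :
    IsSmoothing R (((multiIdx d R).card : ℝ) ^ 2 * (maxConst K R / Tnu α T n ν ^ η)) (Q j k) ∧
    IsSmoothing R (((multiIdx d R).card : ℝ) ^ 2 * (maxConst K R / Tnu α T n ν ^ η))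
      (gridP P T n 1 j k) := by
  have hn : 1 ≤ n := by omega
  have hk1 : k ≤ n ^ 1 := by simpa using hk
  have hj1 : j ≤ n ^ 1 := hjk.trans hk1
  have hmn' : (mOrd α 0 ν : ℝ) < n := by exact_mod_cast hmn
  have hg0 : 0 < ((n : ℝ) - mOrd α 0 ν) / ((mOrd α 0 ν : ℝ) + 1) :=
    div_pos (by linarith) (by positivity)
  have hlt : j < k := by
    have : (j : ℝ) < k := by linarith
    exact_mod_cast this
  have hle : Tnu α T n ν ≤ k * step T n 1 - j * step T n 1 := by
    have := Tnu_le (α := α) (ν := ν) hT hn (g := k - j) (by rwa [Nat.cast_sub hjk])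
    rwa [Nat.cast_sub hjk, sub_mul] at this
  refine ⟨isSmoothing_of_regularizesOn hη hRQ hj1 hk1 hlt (hordQ j k hjk hk)
    (Tnu_pos hT hmn) hle, ?_⟩
  exact isSmoothing_of_regularizesOn hη hRP (grid_mem_Icc hT hn hj1) (grid_mem_Icc hT hn hk1)
    (mul_lt_mul_of_pos_right (by exact_mod_cast hlt) (step_pos hT hn 1)) (hordP j k hjk hk)
    (Tnu_pos hT hmn) hle

/-- The recursion started at level 0 stays on the grids up to `lMax`, since `depth α 0 ν = ⌈ν/α -
1⌉₊`. -/
theorem depth_zero_add_one_le {α ν : ℝ} (hα : 0 < α) (hν : 0 < ν) :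
    0 + depth α 0 ν + 1 ≤ lMax α ν := by
  have h : (ν - ((0 : ℕ) : ℝ) - α * (((0 : ℕ) : ℝ) + 1)) / α = ν / α - 1 := by
    push_cast; field_simp; ring
  have hpos : 0 < ⌈ν / α⌉₊ := Nat.ceil_pos.2 (div_pos hν hα)
  unfold depth lMax
  rw [h, Nat.ceil_sub_one]
  omega

/-- Order zero of propagation of regularity is a uniform bound on test functions, which the kernel
extends to bounded measurable functions. -/
theorem isBPCont_of_hasOrder {d R : ℕ} {A : Op d} {K : ℝ} (hK : 0 ≤ K) (hA : IsKernelOp A)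
    (h : HasOrder R A 0 K) : IsBPCont A K := by
  refine hA.isBPCont hK fun f hf C hC x => ?_
  have h1 := h.le f hf.isSmoothCb 0 (by omega)
  rw [add_zero, normSup_zero, normSup_zero] at h1
  exact (Mb.abs_le_supNorm (A f) x).trans
    (h1.trans (mul_le_mul_of_nonneg_left (supNorm_le hC) hK))

theorem one_add_rpow_le {T : ℝ} (hT : 0 < T) {p : ℝ} (hp : 0 ≤ p) :
    (1 + T) ^ p ≤ 2 ^ p * (1 + T ^ p) := by
  have hTp : 0 ≤ T ^ p := Real.rpow_nonneg hT.le _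
  rcases le_total T 1 with h | h
  · calc (1 + T) ^ p ≤ 2 ^ p := Real.rpow_le_rpow (by linarith) (by linarith) hp
      _ ≤ 2 ^ p * (1 + T ^ p) := le_mul_of_one_le_right (by positivity) (by linarith)
  · calc (1 + T) ^ p ≤ (2 * T) ^ p := Real.rpow_le_rpow (by linarith) (by linarith) hp
      _ = 2 ^ p * T ^ p := Real.mul_rpow (by norm_num) hT.le
      _ ≤ 2 ^ p * (1 + T ^ p) := by gcongr; linarith

end WeakApprox

end

/-! ### The main theorem -/

open WeakApprox in
theorem theorem2p1 (α ν : ℝ) (hα : 0 < α) (hν : 0 < ν) :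
    ∃ p : ℝ, 0 ≤ p ∧
      ∀ (d β : ℕ) (η : ℝ) (K : ℕ → ℝ), 0 < d → 0 ≤ η →
        ∃ C : ℝ, ∀ (T : ℝ) (n : ℕ) (P : ℝ → ℝ → Op d) (Q : ℕ → ℕ → ℕ → Op d),
          0 < T → 1 ≤ n → (mOrd α 0 ν < n ∨ η = 0) →
          IsSemigroupOn (Set.Icc 0 T) P →
          (∀ l ∈ Set.Icc 1 (lMax α ν), IsSemigroupOn (Set.Iic (n ^ l)) (Q l)) →
          Propagates (Set.Icc 0 T) K P →
          (∀ l ∈ Set.Icc 1 (lMax α ν), Propagates (Set.Iic (n ^ l)) K (Q l)) →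
          PropagatesDual (Set.Icc 0 T) K P →
          (∀ l ∈ Set.Icc 1 (lMax α ν), PropagatesDual (Set.Iic (n ^ l)) K (Q l)) →
          (∀ l ∈ Set.Icc 1 (lMax α ν), ShortTime T n l K α β P (Q l)) →
          (∀ l ∈ Set.Icc 1 (lMax α ν), ShortTimeDual T n l K α β P (Q l)) →
          Regularizes (Set.Iic (n ^ 1)) (fun k : ℕ => k * step T n 1) K (qReg α hα β ν) η (Q 1) →
          Regularizes (Set.Icc 0 T) (fun t : ℝ => t) K (qReg α hα β ν) η P →
          ∀ (f : Mb d) (x : E d),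
            |(P 0 T f : E d → ℝ) x - (Qhat α hα n Q 0 ν 0 f : E d → ℝ) x|
              ≤ 1 / (n : ℝ) ^ ν * supNorm (f : E d → ℝ)
                  * (C * (1 + T ^ p) / Tnu α T n ν ^ η) := by
  have hL := depth_zero_add_one_le hα hν
  have hm : 1 ≤ mOrd α 0 ν := Nat.ceil_pos.2 (div_pos hν (by positivity))
  set m := mOrd α 0 ν with hmdef
  choose pf hpf hf using fun i : Fin (m - 1) =>
    exists_errorBound hα 1 (qOrd α (i + 1) 0 ν)
  set p₀ := α + 1 + ∑ i, pf i with hp₀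
  have hp₀α : α + 1 ≤ p₀ := by
    have := Finset.sum_nonneg fun i (_ : i ∈ Finset.univ) => hpf i
    linarith
  have hp₀i : ∀ i, pf i ≤ p₀ := fun i => by
    have := Finset.single_le_sum (fun i _ => hpf i) (Finset.mem_univ i)
    linarith
  have hp₀0 : 0 ≤ p₀ := by linarith
  have hp0 : 0 ≤ p₀ * m := by positivity
  refine ⟨p₀ * m, hp0, fun d β η K hd hη => ?_⟩
  set R := qReg α hα β ν with hR
  set K₀ := maxConst K R with hK₀
  have hK := one_le_maxConst K R
  choose Cf hCf hf' using fun i => hf i d β R K₀ hK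
  set C₀ := K₀ + ∑ i, Cf i with hC₀
  have hC₀K : K₀ ≤ C₀ := by
    have := Finset.sum_nonneg fun i (_ : i ∈ Finset.univ) => hCf i
    linarith
  have hC₀i : ∀ i, Cf i ≤ C₀ := fun i => by
    have := Finset.single_le_sum (fun i _ => hCf i) (Finset.mem_univ i)
    linarith
  have hC₀0 : 0 ≤ C₀ := by linarith
  choose cn hcn using fun n => exists_isBPCont_Qhat hα n K₀ 0 ν
  set N : ℝ := ((multiIdx d R).card : ℝ) with hN
  -- `N ^ 2 * K₀` comes from smoothing, the bracket from the sum over chains, and the power of 2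
  -- from replacing `(1 + T) ^ p` by `1 + T ^ p`.
  set Ca := N ^ 2 * K₀ * (K₀ * (2 * K₀ * C₀) ^ m * ((m : ℝ) ^ 2 + 1)) * 2 ^ (p₀ * m) with hCa
  have hCa0 : 0 ≤ Ca := by positivity
  -- The crude bounds depend on `n`, but are needed in the constant for `n ≤ m` only.
  set Cb := ∑ n ∈ Finset.range (m + 1), |K₀ + cn n| * (n : ℝ) ^ ν with hCb
  have hCb0 : 0 ≤ Cb := Finset.sum_nonneg fun n _ => by positivity
  refine ⟨Ca + Cb, fun T n P Q hT hn hcase hP hQ hPp hQp hPd hQd hs hsd hRQ hRP f x => ?_⟩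
  have hsys : GridSystem α β R (lMax α ν) K₀ T n (gridP P T n) Q :=
    gridSystem_of_hypotheses hT hn hP hQ hPp hQp hPd hQd hs hsd
  have hn0 : (0 : ℝ) < n := by exact_mod_cast hn
  have hPT : gridP P T n 0 0 1 = P 0 T := by simp [gridP, step]
  have hbQ : ∀ l', 1 ≤ l' → l' ≤ lMax α ν → ∀ j k, j ≤ k → k ≤ n ^ l' →
      IsBPCont (Q l' j k) K₀ := fun l' h1 h2 j k hjk hk =>
    isBPCont_of_hasOrder (by linarith)
      ((hQ l' ⟨h1, h2⟩).kernel j (hjk.trans hk) k hk hjk) (hsys.ordQ l' h1 h2 j k hjk hk)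
  have hbP : IsBPCont (gridP P T n 0 0 1) K₀ :=
    isBPCont_of_hasOrder (by linarith)
      (hPT ▸ hP.kernel 0 ⟨le_rfl, hT.le⟩ T ⟨hT.le, le_rfl⟩ hT.le)
      (hsys.ordP 0 0 1 (by omega) (by simp))
  have hbD : IsBPCont (gridP P T n 0 0 1 - Qhat α hα n Q 0 ν 0) (K₀ + cn n) :=
    hbP.sub (hcn n d (lMax α ν) Q hbQ hL 0 (by simp))
  have hval : (P 0 T f : E d → ℝ) x - (Qhat α hα n Q 0 ν 0 f : E d → ℝ) x
      = ((gridP P T n 0 0 1 - Qhat α hα n Q 0 ν 0) f : E d → ℝ) x := by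
    rw [hPT]; rfl
  have hTp : 0 ≤ T ^ (p₀ * m) := Real.rpow_nonneg hT.le _
  have hS := supNorm_nonneg (f : E d → ℝ)
  rw [hval]
  rcases Nat.lt_or_ge m n with hmn | hmn
  · have hTnu := Tnu_pos (α := α) (ν := ν) hT hmn
    have hn' : n ≤ n ^ 1 := by simp
    have hsm := fun j k (hjk : j ≤ k) (hk : k ≤ n) hg =>
      isSmoothing_of_gap (α := α) (ν := ν) hη hT hmn
        (fun j k hjk hk => hsys.ordP 1 j k hjk (hk.trans hn'))
        (fun j k hjk hk => hsys.ordQ 1 le_rfl (by omega) j k hjk (hk.trans hn'))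
        hRQ hRP (j := j) (k := k) hjk hk hg
    set G := N ^ 2 * (K₀ / Tnu α T n ν ^ η) with hG
    have hG0 : 0 ≤ G := by positivity
    have key := error_gainsOrder hα hsys (by omega) hm hmn hC₀K hp₀α (G := G)
      (fun i => (hf' i (lMax α ν) T n _ Q hsys (by
        have := depth_lt hα 0 ν i
        simp only [zero_add] at this
        omega)).mono hT.le (hC₀i i) hC₀0 (hp₀i i))
      ⟨hG0, fun j k hjk hk hg => (hsm j k hjk hk hg).1,
        fun j hj hg => (hsm j n hj le_rfl hg).1⟩
      ⟨hG0, fun j k hjk hk hg => (hsm j k hjk hk hg).1,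
        fun j hj hg => (hsm j n hj le_rfl hg).2⟩
    have hU : 0 ≤ (1 + T) ^ p₀ := Real.rpow_nonneg (by linarith) _
    set M := G * (K₀ * (2 * K₀ * C₀ * (1 + T) ^ p₀) ^ m * ((m : ℝ) ^ 2 + 1)
      * (n : ℝ) ^ (-ν)) with hM
    have hM0 : 0 ≤ M := by positivity
    -- The `n`-dependent constant `cn n` supplies only the continuity needed to pass to measurable
    -- `f`; the bound itself is `M`, from test functions.
    have h1 := hbD.abs_le_of_test hM0 x (fun φ hφ C hC => by
      have h2 := (key φ hφ.isSmoothCb).2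
      rw [normSup_zero] at h2
      exact (Mb.abs_le_supNorm _ x).trans
        (h2.trans (mul_le_mul_of_nonneg_left (supNorm_le hC) hM0))) f
      (Mb.abs_le_supNorm f)
    refine h1.trans ?_
    have hpow : ((1 + T) ^ p₀) ^ m ≤ 2 ^ (p₀ * m) * (1 + T ^ (p₀ * m)) := by
      rw [← Real.rpow_natCast, ← Real.rpow_mul (by linarith)]
      exact one_add_rpow_le hT hp0
    calc M * supNorm (f : E d → ℝ)
        = (n : ℝ) ^ (-ν) * supNorm (f : E d → ℝ) *
          (N ^ 2 * K₀ * (K₀ * (2 * K₀ * C₀) ^ m * ((m : ℝ) ^ 2 + 1)) * ((1 + T) ^ p₀) ^ m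
            / Tnu α T n ν ^ η) := by rw [hM, hG, mul_pow (2 * K₀ * C₀)]; ring
      _ ≤ (n : ℝ) ^ (-ν) * supNorm (f : E d → ℝ) *
          (N ^ 2 * K₀ * (K₀ * (2 * K₀ * C₀) ^ m * ((m : ℝ) ^ 2 + 1))
            * (2 ^ (p₀ * m) * (1 + T ^ (p₀ * m))) / Tnu α T n ν ^ η) := by gcongr
      _ = (n : ℝ) ^ (-ν) * supNorm (f : E d → ℝ) *
          (Ca * (1 + T ^ (p₀ * m)) / Tnu α T n ν ^ η) := by rw [hCa]; ring
      _ ≤ (n : ℝ) ^ (-ν) * supNorm (f : E d → ℝ) *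
          ((Ca + Cb) * (1 + T ^ (p₀ * m)) / Tnu α T n ν ^ η) := by gcongr; linarith
      _ = _ := by rw [Real.rpow_neg hn0.le, one_div]
  -- No gap need be long when `n ≤ m`; but `T(ν)^η = 1`, and boundedness suffices for these finitely
  -- many `n`.
  · have hη0 : η = 0 := hcase.resolve_left (by omega)
    have h1 := hbD.bound f _ (Mb.abs_le_supNorm f) x
    refine h1.trans ?_
    have hnν : 0 < (n : ℝ) ^ ν := Real.rpow_pos_of_pos hn0 _
    have h2 : |K₀ + cn n| * (n : ℝ) ^ ν ≤ Cb :=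
      Finset.single_le_sum (f := fun n : ℕ => |K₀ + cn n| * (n : ℝ) ^ ν)
        (fun n _ => by positivity) (Finset.mem_range.2 (Nat.lt_succ_of_le hmn))
    have h3 : K₀ + cn n ≤ 1 / (n : ℝ) ^ ν * ((Ca + Cb) * (1 + T ^ (p₀ * m))) := by
      rw [one_div, inv_mul_eq_div, le_div_iff₀ hnν]
      calc (K₀ + cn n) * (n : ℝ) ^ ν ≤ |K₀ + cn n| * (n : ℝ) ^ ν := by
            gcongr; exact le_abs_self _
        _ ≤ Ca + Cb := by linarith
        _ ≤ (Ca + Cb) * (1 + T ^ (p₀ * m)) :=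
            le_mul_of_one_le_right (by linarith) (by linarith)
    rw [hη0, Real.rpow_zero, div_one]
    calc (K₀ + cn n) * supNorm (f : E d → ℝ)
        ≤ 1 / (n : ℝ) ^ ν * ((Ca + Cb) * (1 + T ^ (p₀ * m))) * supNorm (f : E d → ℝ) := by
          gcongr
      _ = _ := by ring
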